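/- All graphs are finite, simple and undirected. A \emph{chordal bipartite} graph is a bipartite graph without induced cycles of length at least $6$. A \emph{total dominating set} of $G$ is a set $S\subseteq V(G)$ such that every vertex of $G$ has a neighbor in $S$; the minimum size of such a set is $\gamma_t(G)$ (it exists if and only if $G$ has no isolated vertex). A \emph{cd-coloring} of $G$ is a proper vertex coloring in which every (non-empty) color class is contained in the open neighborhood $N(v)$ of some vertex $v$, except that an isolated vertex of $G$ forms a color class of its own; the minimum number of colors is $\chi_{cd}(G)$. A \emph{separated-cluster} of $G$ is a set of vertices no two of which are at distance exactly $2$ in $G$; the maximum size of such a set is $\omega_s(G)$. $G$ is \emph{cd-perfect} if $\chi_{cd}(H)=\omega_s(H)$ for every induced subgraph $H$ of $G$. For a graph $G$ and an integer $k\ge 0$, the problems \textsc{Total Domination}, \textsc{CD-coloring} and \textsc{Separated-Cluster} ask whether $G$ has, respectively, a total dominating set of size at most $k$, a cd-coloring with at most $k$ colors, a separated-cluster of size at least $k$; in their optimization versions they ask for $\gamma_t(G)$, $\chi_{cd}(G)$, $\omega_s(G)$. \textbf{Theorem.} Every chordal bipartite graph $G$ is cd-perfect. Consequently, the three problems are equivalent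 on chordal bipartite graphs: $\chi_{cd}(G)=\omega_s(G)$, so that $G$ has a cd-coloring with at most $k$ colors if and only if it has no separated-cluster of size at least $k+1$; and if $G$ has no isolated vertex, then also $\gamma_t(G)=\chi_{cd}(G)$, so that $G$ has a total dominating set of size at most $k$ if and only if it has a cd-coloring with at most $k$ colors. Moreover, all three problems, in the decision and in the optimization version, can be solved on chordal bipartite graphs with $n$ vertices in $O(n^2)$ time (on a word RAM, with the graph given by its adjacency matrix; for the computation of $\gamma_t(G)$ the graph is assumed to have no isolated vertex). -/

import Mathlib

namespace SimpleGraph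

variable {V : Type*}

/-- A chordal bipartite graph: bipartite, without an induced cycle of length at least `6`. -/
def IsChordalBipartite (G : SimpleGraph V) : Prop :=
  G.IsBipartite ∧ ∀ k : ℕ, 6 ≤ k → ¬ (cycleGraph k).IsIndContained G

/-- No vertex is isolated. -/
def NoIsolatedVertex (G : SimpleGraph V) : Prop :=
  ∀ v, ∃ w, G.Adj v w

/-- Every vertex of the graph (also those in `S`) has a neighbor in `S`. -/
def IsTotalDominatingSet (G : SimpleGraph V) (S : Finset V) : Prop :=
  ∀ v, ∃ w ∈ S, G.Adj v w

/-- No two vertices of `S` lie at distance exactly `2`. (`dist` is `0` for two vertices in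
different components, so such vertices are allowed.) -/
def IsSeparatedCluster (G : SimpleGraph V) (S : Finset V) : Prop :=
  ∀ u ∈ S, ∀ v ∈ S, G.dist u v ≠ 2

/-- A cd-coloring: a proper coloring in which the color class of every vertex `u` is contained in
the open neighborhood of some vertex `v`. The second alternative concerns only isolated vertices `u`
(which lie in no neighborhood): such a vertex has to form a color class of its own. It never
applies in a graph without isolated vertices, and is needed for induced subgraphs. -/
def IsCDColoring (G : SimpleGraph V) {α : Type*} (c : G.Coloring α) : Prop :=
  ∀ u, (∃ v, ∀ w, c w = c u → G.Adj v w) ∨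
    ((∀ w, ¬ G.Adj u w) ∧ ∀ w, c w = c u → w = u)

/-- TOTAL DOMINATION: is there a total dominating set of size at most `k`? -/
def TotalDomination (G : SimpleGraph V) (k : ℕ) : Prop :=
  ∃ S : Finset V, G.IsTotalDominatingSet S ∧ S.card ≤ k

/-- CD-COLORING: is there a cd-coloring with at most `k` colors? -/
def CDColorable (G : SimpleGraph V) (k : ℕ) : Prop :=
  ∃ c : G.Coloring (Fin k), G.IsCDColoring c

/-- SEPARATED-CLUSTER: is there a separated-cluster of size at least `k`? -/
def SeparatedCluster (G : SimpleGraph V) (k : ℕ) : Prop :=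
  ∃ S : Finset V, G.IsSeparatedCluster S ∧ k ≤ S.card

/-- The total domination number (`⊤` if there is no total dominating set). -/
noncomputable def totalDominationNumber (G : SimpleGraph V) : ℕ∞ :=
  ⨅ (S : Finset V) (_ : G.IsTotalDominatingSet S), (S.card : ℕ∞)

/-- The cd-chromatic number. -/
noncomputable def cdChromaticNumber (G : SimpleGraph V) : ℕ∞ :=
  ⨅ (k : ℕ) (_ : G.CDColorable k), (k : ℕ∞)

/-- The separated-cluster number. -/
noncomputable def separatedClusterNumber (G : SimpleGraph V) : ℕ∞ :=
  ⨆ (S : Finset V) (_ : G.IsSeparatedCluster S), (S.card : ℕ∞)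

/-- cd-perfect: every induced subgraph has equal cd-chromatic and separated-cluster numbers. -/
def IsCDPerfect (G : SimpleGraph V) : Prop :=
  ∀ s : Set V, (G.induce s).cdChromaticNumber = (G.induce s).separatedClusterNumber

end SimpleGraph

/-! A word RAM with structured control flow. -/

namespace WordRAM

/-- Programs. A program uses finitely many registers `R[0], R[1], …` and a memory
`M[0], M[1], …` that is accessed by indirect addressing. -/
inductive Program : Type
  /-- do nothing -/
  | skip : Program
  /-- `R[x] := c` -/
  | const (x c : ℕ) : Program
  /-- `R[x] := R[y]` -/
  | move (x y : ℕ) : Program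
  /-- `R[x] := R[y] + R[z]` -/
  | add (x y z : ℕ) : Program
  /-- `R[x] := max (R[y] - R[z]) 0` -/
  | sub (x y z : ℕ) : Program
  /-- `R[x] := M[R[y]]` -/
  | load (x y : ℕ) : Program
  /-- `M[R[x]] := R[y]` -/
  | store (x y : ℕ) : Program
  /-- first `p`, then `q` -/
  | seq (p q : Program) : Program
  /-- if `R[x] ≠ 0` then `p` else `q` -/
  | ite (x : ℕ) (p q : Program) : Program
  /-- while `R[x] ≠ 0` do `p` -/
  | while (x : ℕ) (p : Program) : Program

/-- A state of the machine: the contents of the registers and of the memory. -/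
structure State : Type where
  reg : ℕ → ℕ
  mem : ℕ → ℕ

/-- Write `a` into register `x`. -/
def State.setReg (s : State) (x a : ℕ) : State :=
  { s with reg := Function.update s.reg x a }

/-- Write `b` into memory cell `a`. -/
def State.setMem (s : State) (a b : ℕ) : State :=
  { s with mem := Function.update s.mem a b }

/-- `Exec W p s t s'`: started in state `s`, the program `p` halts in state `s'` after exactly `t`
steps, and every number it computes is smaller than `W`, so that it fits into a machine word (a run
with an overflow is not an execution). Every instruction and every test of a branch or of a loop
is one step. -/
inductive Exec (W : ℕ) : Program → State → ℕ → State → Prop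
  | skip (s : State) : Exec W .skip s 1 s
  | const (s : State) (x c : ℕ) (h : c < W) : Exec W (.const x c) s 1 (s.setReg x c)
  | move (s : State) (x y : ℕ) : Exec W (.move x y) s 1 (s.setReg x (s.reg y))
  | add (s : State) (x y z : ℕ) (h : s.reg y + s.reg z < W) :
      Exec W (.add x y z) s 1 (s.setReg x (s.reg y + s.reg z))
  | sub (s : State) (x y z : ℕ) : Exec W (.sub x y z) s 1 (s.setReg x (s.reg y - s.reg z))
  | load (s : State) (x y : ℕ) : Exec W (.load x y) s 1 (s.setReg x (s.mem (s.reg y)))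
  | store (s : State) (x y : ℕ) : Exec W (.store x y) s 1 (s.setMem (s.reg x) (s.reg y))
  | seq {p q : Program} {s s₁ s₂ : State} {t₁ t₂ : ℕ} (h₁ : Exec W p s t₁ s₁)
      (h₂ : Exec W q s₁ t₂ s₂) : Exec W (.seq p q) s (t₁ + t₂) s₂
  | ite_true {x : ℕ} {p q : Program} {s s' : State} {t : ℕ} (hx : s.reg x ≠ 0)
      (h : Exec W p s t s') : Exec W (.ite x p q) s (t + 1) s'
  | ite_false {x : ℕ} {p q : Program} {s s' : State} {t : ℕ} (hx : s.reg x = 0)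
      (h : Exec W q s t s') : Exec W (.ite x p q) s (t + 1) s'
  | while_true {x : ℕ} {p : Program} {s s₁ s₂ : State} {t₁ t₂ : ℕ} (hx : s.reg x ≠ 0)
      (h₁ : Exec W p s t₁ s₁) (h₂ : Exec W (.while x p) s₁ t₂ s₂) :
      Exec W (.while x p) s (t₁ + t₂ + 1) s₂
  | while_false {x : ℕ} {p : Program} {s : State} (hx : s.reg x = 0) :
      Exec W (.while x p) s 1 s

open Classical in
/-- The initial state for a graph `G` with vertices `0, …, n - 1` and a number `k`: register `0`
holds `n`, register `1` holds `k`, the first `n * n` memory cells hold the adjacency matrix of `G`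
row by row, and everything else is `0`. -/
noncomputable def inputState {n : ℕ} (G : SimpleGraph (Fin n)) (k : ℕ) : State where
  reg x := if x = 0 then n else if x = 1 then k else 0
  mem a := if ∃ i j : Fin n, a = i * n + j ∧ G.Adj i j then 1 else 0

/-- The parameter `f` of the graphs in the class `𝒞` can be computed in time `O(T(n))`, where `n` is
the number of vertices: a single program, started on any graph in `𝒞` (given by its adjacency
matrix), halts after `O(T(n))` steps with the value of `f` in register `0`, on a machine with words
of `O(log n)` bits. -/
def ComputableInTime (𝒞 : ∀ ⦃n : ℕ⦄, SimpleGraph (Fin n) → Prop)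
    (f : ∀ ⦃n : ℕ⦄, SimpleGraph (Fin n) → ℕ∞) (T : ℕ → ℕ) : Prop :=
  ∃ (P : Program) (C : ℕ), ∀ (n : ℕ) (G : SimpleGraph (Fin n)), 𝒞 G →
    ∃ (t : ℕ) (s : State), Exec ((n + 2) ^ C) P (inputState G 0) t s ∧
      t ≤ C * T n + C ∧ (s.reg 0 : ℕ∞) = f G

/-- The decision problem `Q`, whose inputs are a graph in the class `𝒞` and a number `k`, can be
decided in time `O(T(n))`, where `n` is the number of vertices, on a machine with words of
`O(log (n + k))` bits: the answer is `1` (yes) or `0` (no) in register `0`. -/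
def DecidableInTime (𝒞 : ∀ ⦃n : ℕ⦄, SimpleGraph (Fin n) → Prop)
    (Q : ∀ ⦃n : ℕ⦄, SimpleGraph (Fin n) → ℕ → Prop) (T : ℕ → ℕ) : Prop :=
  ∃ (P : Program) (C : ℕ), ∀ (n : ℕ) (G : SimpleGraph (Fin n)) (k : ℕ), 𝒞 G →
    ∃ (t : ℕ) (s : State), Exec ((n + k + 2) ^ C) P (inputState G k) t s ∧
      t ≤ C * T n + C ∧ (Q G k → s.reg 0 = 1) ∧ (¬ Q G k → s.reg 0 = 0)

end WordRAM

/-! Everything follows from one min-max statement (`HasCoverPacking`): in a chordal bipartite graph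
some number `c` is both the size of a family of open neighborhoods covering all non-isolated
vertices and the size of a set of non-isolated vertices no two of which have a common neighbor. In a
bipartite graph, distinct vertices are at distance 2 exactly if they have a common neighbor, and
open neighborhoods are independent. So the cover, with one extra class per isolated vertex, gives a
cd-coloring, the packing together with the isolated vertices is a separated-cluster, and no color
class holds two vertices of a separated-cluster: both parameters equal `c` plus the number of
isolated vertices. Without isolated vertices the cover is a total dominating set, and no vertex
dominates two vertices of the packing. Chordal bipartiteness is hereditary, hence cd-perfectness.

For the min-max statement, order the vertices by a search that always takes a vertex with the most
neighbors among the vertices reached so far, that is, those with a listed neighbor. The key is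
`IsChordalBipartite.adj_of_isFirstNeighbor`: if `y` and `y'` have a common neighbor, the later of
their first neighbors is adjacent to both. A violation is an induced path whose inner vertices come
late, and `exists_latePath_lt` turns such a path into one ending earlier, or else finds a long
induced cycle. Now go through the order backwards; whenever some `p` with first neighbor `ord i` is
uncovered, put `ord i` into the cover and `p` into the packing. Every vertex sharing a neighbor with
`p` is then covered: by the old cover if its first neighbor is later than `ord i`, and by `ord i`
otherwise (`IsGreedy.pick`). So no later choice conflicts with `p`.

The search takes quadratic time because the counters of the neighbors of a vertex are updated only
once, when that vertex is first reached; all other work is linear per round. The min-max statement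
itself is read off from the correctness of the program. -/

/-! ### A calculus for halting runs of the word RAM. -/

namespace WordRAM

/-- `p`, started in `s`, halts after some number `t` of steps in a state `s'` with `Q t s'`. -/
def Halts (W : ℕ) (p : Program) (Q : ℕ → State → Prop) (s : State) : Prop :=
  ∃ t s', Exec W p s t s' ∧ Q t s'

namespace Halts

variable {W : ℕ} {Q : ℕ → State → Prop} {s : State}

theorem mono {p : Program} {Q' : ℕ → State → Prop} (h : Halts W p Q s)
    (hQ : ∀ t s', Q t s' → Q' t s') : Halts W p Q' s := by
  obtain ⟨t, s', he, hq⟩ := h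
  exact ⟨t, s', he, hQ _ _ hq⟩

/-- This and the following equivalences are weakest-precondition rules; as rewrite rules they
execute loop-free code symbolically and count its steps. -/
theorem skip_iff : Halts W .skip Q s ↔ Q 1 s :=
  ⟨fun ⟨_, _, h, hq⟩ => by cases h; exact hq, fun h => ⟨_, _, .skip s, h⟩⟩

theorem const_iff {x c : ℕ} : Halts W (.const x c) Q s ↔ c < W ∧ Q 1 (s.setReg x c) :=
  ⟨fun ⟨_, _, h, hq⟩ => by cases h with | const _ _ _ h => exact ⟨h, hq⟩,
    fun h => ⟨_, _, .const s x c h.1, h.2⟩⟩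

theorem move_iff {x y : ℕ} : Halts W (.move x y) Q s ↔ Q 1 (s.setReg x (s.reg y)) :=
  ⟨fun ⟨_, _, h, hq⟩ => by cases h; exact hq, fun h => ⟨_, _, .move s x y, h⟩⟩

theorem add_iff {x y z : ℕ} : Halts W (.add x y z) Q s ↔
    s.reg y + s.reg z < W ∧ Q 1 (s.setReg x (s.reg y + s.reg z)) :=
  ⟨fun ⟨_, _, h, hq⟩ => by cases h with | add _ _ _ _ h => exact ⟨h, hq⟩,
    fun h => ⟨_, _, .add s x y z h.1, h.2⟩⟩

theorem sub_iff {x y z : ℕ} : Halts W (.sub x y z) Q s ↔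
    Q 1 (s.setReg x (s.reg y - s.reg z)) :=
  ⟨fun ⟨_, _, h, hq⟩ => by cases h; exact hq, fun h => ⟨_, _, .sub s x y z, h⟩⟩

theorem load_iff {x y : ℕ} : Halts W (.load x y) Q s ↔
    Q 1 (s.setReg x (s.mem (s.reg y))) :=
  ⟨fun ⟨_, _, h, hq⟩ => by cases h; exact hq, fun h => ⟨_, _, .load s x y, h⟩⟩

theorem store_iff {x y : ℕ} : Halts W (.store x y) Q s ↔
    Q 1 (s.setMem (s.reg x) (s.reg y)) :=
  ⟨fun ⟨_, _, h, hq⟩ => by cases h; exact hq, fun h => ⟨_, _, .store s x y, h⟩⟩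

theorem seq_iff {p q : Program} : Halts W (.seq p q) Q s ↔
    Halts W p (fun t s' => Halts W q (fun t' s'' => Q (t + t') s'') s') s :=
  ⟨fun ⟨_, _, h, hq⟩ => by cases h with | seq h₁ h₂ => exact ⟨_, _, h₁, _, _, h₂, hq⟩,
    fun ⟨_, _, h₁, _, _, h₂, hq⟩ => ⟨_, _, .seq h₁ h₂, hq⟩⟩

theorem ite_iff {x : ℕ} {p q : Program} : Halts W (.ite x p q) Q s ↔
    (s.reg x ≠ 0 → Halts W p (fun t s' => Q (t + 1) s') s) ∧
      (s.reg x = 0 → Halts W q (fun t s' => Q (t + 1) s') s) := by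
  constructor
  · rintro ⟨t, s', h, hq⟩
    cases h with
    | ite_true hx h => exact ⟨fun _ => ⟨_, _, h, hq⟩, fun h0 => absurd h0 hx⟩
    | ite_false hx h => exact ⟨fun h0 => absurd hx h0, fun _ => ⟨_, _, h, hq⟩⟩
  · rintro ⟨h₁, h₂⟩
    by_cases hx : s.reg x = 0
    · obtain ⟨t, s', h, hq⟩ := h₂ hx
      exact ⟨_, _, .ite_false hx h, hq⟩
    · obtain ⟨t, s', h, hq⟩ := h₁ hx
      exact ⟨_, _, .ite_true hx h, hq⟩

/-- A loop that runs `m` times. The invariant `I j t s` holds after `j` rounds and `t` steps. -/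
theorem while_of_invariant {x : ℕ} {p : Program} {m : ℕ} (I : ℕ → ℕ → State → Prop)
    (h0 : I 0 0 s) (hx : ∀ j t s, I j t s → s.reg x = m - j)
    (hp : ∀ j t s, j < m → I j t s → Halts W p (fun t' s' => I (j + 1) (t + t' + 1) s') s)
    (hQ : ∀ t s, I m t s → Q (t + 1) s) : Halts W (.while x p) Q s := by
  suffices H : ∀ d j t s, j + d = m → I j t s →
      Halts W (.while x p) (fun t' s' => Q (t + t') s') s by
    simpa using H m 0 0 s (by omega) h0
  intro d
  induction d with
  | zero =>
    intro j t s hj hI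
    obtain rfl : j = m := by omega
    exact ⟨1, s, .while_false (by simpa using hx _ _ _ hI), hQ _ _ hI⟩
  | succ d ih =>
    intro j t s hj hI
    obtain ⟨t₁, s₁, he, hI₁⟩ := hp j t s (by omega) hI
    obtain ⟨t₂, s₂, he₂, hq⟩ := ih (j + 1) _ s₁ (by omega) hI₁
    refine ⟨_, _, .while_true (by rw [hx _ _ _ hI]; omega) he he₂, ?_⟩
    convert hq using 1
    omega

end Halts

end WordRAM

/-! ### Maximum cardinality search and induced paths in chordal bipartite graphs. -/

namespace SimpleGraph

variable {V : Type*} {G : SimpleGraph V}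

/-- `p 0, p 1, …, p m` is an induced path. -/
def IsInducedPath (G : SimpleGraph V) (p : ℕ → V) (m : ℕ) : Prop :=
  ∀ i j, i < j → j ≤ m → (G.Adj (p i) (p j) ↔ j = i + 1)

theorem IsInducedPath.reverse {p : ℕ → V} {m : ℕ} (h : G.IsInducedPath p m) :
    G.IsInducedPath (fun i => p (m - i)) m := by
  intro i j hij hj
  rw [G.adj_comm, h (m - j) (m - i) (by omega) (by omega)]
  omega

theorem IsInducedPath.color_eq {p : ℕ → V} {m : ℕ} (h : G.IsInducedPath p m)
    (col : G.Coloring Bool) : ∀ i ≤ m, col (p i) = (col (p 0) ^^ decide (i % 2 = 1)) := by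
  intro i
  induction i with
  | zero => simp
  | succ i ih =>
    intro hi
    have h1 := col.valid ((h i (i + 1) (by omega) hi).2 rfl)
    rw [ih (by omega)] at h1
    rcases Nat.mod_two_eq_zero_or_one i with h2 | h2
    · have h3 : (i + 1) % 2 = 1 := by omega
      revert h1; simp only [h2, h3]; cases col (p 0) <;> cases col (p (i + 1)) <;> simp
    · have h3 : (i + 1) % 2 = 0 := by omega
      revert h1; simp only [h2, h3]; cases col (p 0) <;> cases col (p (i + 1)) <;> simp

theorem cycleGraph_isIndContained {q : ℕ → V} {m : ℕ} (hm : 5 ≤ m)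
    (h : ∀ i j, i < j → j ≤ m → (G.Adj (q i) (q j) ↔ j = i + 1 ∨ (i = 0 ∧ j = m))) :
    (cycleGraph (m + 1)).IsIndContained G := by
  have hadj : ∀ i j, i ≤ m → j ≤ m → (G.Adj (q i) (q j) ↔
      j = i + 1 ∨ i = j + 1 ∨ (i = 0 ∧ j = m) ∨ (j = 0 ∧ i = m)) := by
    intro i j hi hj
    rcases lt_trichotomy i j with hij | rfl | hij
    · rw [h i j hij hj]; omega
    · simp; omega
    · rw [G.adj_comm, h j i hij hi]; omega
  -- Injectivity need not be assumed: in a cycle with at least five vertices, distinct vertices have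
  -- distinct neighborhoods.
  have hinj : ∀ i j, i ≤ m → j ≤ m → q i = q j → i = j := by
    intro i j hi hj heq
    have key : ∀ l ≤ m, ((l = i + 1 ∨ i = l + 1 ∨ (i = 0 ∧ l = m) ∨ (l = 0 ∧ i = m)) ↔
        (l = j + 1 ∨ j = l + 1 ∨ (j = 0 ∧ l = m) ∨ (l = 0 ∧ j = m))) := fun l hl => by
      rw [← hadj i l hi hl, ← hadj j l hj hl, heq]
    have h1 : i < m → _ := fun h => key (i + 1) (by omega)
    have h2 := key (i - 1) (by omega)
    have h3 := key 0 (by omega)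
    have h4 := key m le_rfl
    omega
  refine ⟨⟨⟨fun i => q i, fun i j hij => Fin.ext (hinj i j (by omega) (by omega) hij)⟩,
    fun {i j} => ?_⟩⟩
  change G.Adj (q i) (q j) ↔ _
  rw [hadj i j (by omega) (by omega), cycleGraph_adj']
  rcases lt_trichotomy i j with hij | rfl | hij
  · rw [Fin.coe_sub_iff_lt.2 hij, Fin.coe_sub_iff_le.2 hij.le]
    have : (i : ℕ) < j := hij
    omega
  · simp only [sub_self, Fin.val_zero]; omega
  · rw [Fin.coe_sub_iff_lt.2 hij, Fin.coe_sub_iff_le.2 hij.le]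
    have : (j : ℕ) < i := hij
    omega

/-- The vertices `ord 0, …, ord (n - 1)` are ordered by a maximum cardinality search for the
hypergraph of the open neighborhoods: no vertex `x` that is not listed before `ord i` has, among the
vertices with a neighbor in `ord 0, …, ord (i - 1)`, properly more neighbors than `ord i`. -/
def IsMaxSearchOrder (G : SimpleGraph V) (ord : ℕ → V) (n : ℕ) : Prop :=
  ∀ i < n, ∀ x, (∀ l < i, ord l ≠ x) →
    (∃ y, (∃ l < i, G.Adj (ord l) y) ∧ G.Adj x y ∧ ¬ G.Adj (ord i) y) →
    ∃ z, (∃ l < i, G.Adj (ord l) z) ∧ G.Adj (ord i) z ∧ ¬ G.Adj x z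

/-- `ord i` is the first neighbor of `y`. -/
def IsFirstNeighbor (G : SimpleGraph V) (ord : ℕ → V) (i : ℕ) (y : V) : Prop :=
  G.Adj (ord i) y ∧ ∀ l < i, ¬ G.Adj (ord l) y

/-- An induced path from `ord a` to `ord c` whose inner vertices come late in the order. -/
structure IsLatePath (G : SimpleGraph V) (ord : ℕ → V) (a c k : ℕ) (p : ℕ → V) : Prop where
  lt : a < c
  two_le : 2 ≤ k
  left : p 0 = ord a
  right : p (2 * k) = ord c
  induced : G.IsInducedPath p (2 * k)
  first : ∀ l < a, ¬ G.Adj (ord l) (p 1)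
  late : ∀ i, 1 ≤ i → i < k → ∀ l < c, ¬ G.Adj (ord l) (p (2 * i + 1))

/-- The descent step. When `ord c` was chosen, `p 2` was also available and had the reached neighbor
`p 1`, which `ord c` lacks. So `ord c` has a reached neighbor `z` that `p 2` lacks. Cutting the path
at its first even vertex after `p 0` that is adjacent to `z`, and continuing to `z` and to the first
neighbor `ord b` of `z`, gives a late path whose ends both precede `ord c`; any unwanted chord would
close an induced cycle of length at least 6. -/
theorem IsChordalBipartite.exists_latePath_lt (hG : G.IsChordalBipartite) {ord : ℕ → V} {n : ℕ}
    (hord : G.IsMaxSearchOrder ord n) {a c k : ℕ} {p : ℕ → V} (hc : c < n)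
    (hp : G.IsLatePath ord a c k p) : ∃ a' c' k' p', c' < c ∧ G.IsLatePath ord a' c' k' p' := by
  classical
  obtain ⟨hac, hk, hleft, hright, hind, hfirst, hlate⟩ := hp
  have col : G.Coloring Bool := G.recolorOfEquiv finTwoEquiv hG.1.some
  have hcolor := hind.color_eq col
  have hadj : ∀ i, i < 2 * k → G.Adj (p i) (p (i + 1)) := fun i hi =>
    (hind i (i + 1) (by omega) (by omega)).2 rfl
  have hnadj : ∀ i j, i + 1 < j → j ≤ 2 * k → ¬ G.Adj (p i) (p j) := fun i j hij hj h => by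
    have := (hind i j (by omega) hj).1 h; omega
  -- `p 2` is not listed before `ord c`, because its neighbor `p 3` has no neighbor there.
  obtain ⟨z, hz, hcz, hxz⟩ := hord c hc (p 2)
    (fun l hl h => hlate 1 le_rfl (by omega) l hl (h ▸ hadj 2 (by omega)))
    ⟨p 1, ⟨a, hac, hleft ▸ hadj 0 (by omega)⟩, (hadj 1 (by omega)).symm,
      fun h => hnadj 1 (2 * k) (by omega) le_rfl (hright ▸ h).symm⟩
  obtain ⟨b, hb, hbz, hbmin⟩ : ∃ b < c, G.Adj (ord b) z ∧ ∀ l < b, ¬ G.Adj (ord l) z := by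
    refine ⟨Nat.find hz, (Nat.find_spec hz).1, (Nat.find_spec hz).2, fun l hl h => ?_⟩
    exact Nat.find_min hz hl ⟨hl.trans (Nat.find_spec hz).1, h⟩
  have hj : ∃ j, 1 ≤ j ∧ G.Adj (p (2 * j)) z := ⟨k, by omega, hright ▸ hcz⟩
  obtain ⟨j, hjk, hj1, hjz, hjmin⟩ : ∃ j ≤ k, 1 ≤ j ∧ G.Adj (p (2 * j)) z ∧
      ∀ i < j, 1 ≤ i → ¬ G.Adj (p (2 * i)) z :=
    ⟨Nat.find hj, Nat.find_min' hj ⟨by omega, hright ▸ hcz⟩, (Nat.find_spec hj).1,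
      (Nat.find_spec hj).2, fun i hi h1 h2 => Nat.find_min hj hi ⟨h1, h2⟩⟩
  -- This makes the cycles below, which have `2 * j + 2` vertices, long enough to be forbidden.
  have hj2 : 2 ≤ j := by
    by_contra h
    obtain rfl : j = 1 := by omega
    exact hxz hjz
  have hcolz : col z = !col (p 0) := by
    have h1 := col.valid (hright ▸ hcz : G.Adj (p (2 * k)) z)
    rw [hcolor _ le_rfl] at h1
    revert h1
    cases col (p 0) <;> cases col z <;> simp
  have hcolb : col (ord b) = col (p 0) := by
    have h1 := col.valid hbz
    rw [hcolz] at h1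
    revert h1
    cases col (p 0) <;> cases col (ord b) <;> simp
  have hcoladj : ∀ {u v}, col u = col v → ¬ G.Adj u v := fun h h' => col.valid h' h
  -- `z` is adjacent to no inner vertex of the path before `p (2 * j)`
  have hzp : ∀ i, 1 ≤ i → i < 2 * j → ¬ G.Adj (p i) z := by
    intro i h1 hi
    rcases Nat.mod_two_eq_zero_or_one i with h2 | h2
    · obtain ⟨r, rfl⟩ : ∃ r, i = 2 * r := ⟨i / 2, by omega⟩
      exact hjmin r (by omega) (by omega)
    · exact hcoladj (by rw [hcolor i (by omega), hcolz, h2]; simp)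
  -- `ord b` is adjacent to no vertex of the path after `p 1`
  have hbp : ∀ i, 2 ≤ i → i ≤ 2 * j → ¬ G.Adj (ord b) (p i) := by
    intro i h1 hi
    rcases Nat.mod_two_eq_zero_or_one i with h2 | h2
    · exact hcoladj (by rw [hcolor i (by omega), hcolb, h2]; simp)
    · obtain ⟨r, rfl⟩ : ∃ r, i = 2 * r + 1 := ⟨i / 2, by omega⟩
      exact hlate r (by omega) (by omega) b hb
  -- a vertex that closes the path to an induced cycle
  have hcycle : ∀ x, G.Adj x (p 1) → G.Adj x z → (∀ i, 2 ≤ i → i ≤ 2 * j → ¬ G.Adj x (p i)) →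
      False := by
    intro x hx1 hxz hxp
    refine hG.2 (2 * j + 1 + 1) (by omega) (cycleGraph_isIndContained
      (q := fun i => if i = 0 then x else if i ≤ 2 * j then p i else z) (by omega) ?_)
    intro i l hil hl
    have hl0 : l ≠ 0 := by omega
    by_cases hi0 : i = 0
    · by_cases hlj : l ≤ 2 * j
      · by_cases hl1 : l = 1
        · subst hl1; simp [hi0, hx1, show 1 ≤ 2 * j by omega]
        · simp only [hi0, hl0, hlj, if_true, if_false, hxp l (by omega) hlj, false_iff]; omega
      · simp only [hi0, hl0, hlj, if_true, if_false, hxz, true_iff]; simp; omega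
    · have hij : i ≤ 2 * j := by omega
      by_cases hlj : l ≤ 2 * j
      · simp only [hi0, hl0, hlj, hij, if_true, if_false, hind i l hil (by omega)]; simp
      · by_cases hi : i = 2 * j
        · subst hi; simp only [hi0, hl0, hlj, hij, if_true, if_false, hjz, true_iff]; omega
        · simp only [hi0, hl0, hlj, hij, if_true, if_false, hzp i (by omega) (by omega), false_iff]
          simp; omega
  have h0z : ¬ G.Adj (p 0) z := fun h =>
    hcycle (p 0) (hadj 0 (by omega)) h fun i h1 h2 => hnadj 0 i (by omega) (by omega)
  have hb1 : ¬ G.Adj (ord b) (p 1) := fun h => hcycle (ord b) h hbz hbp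
  have hb0 : ¬ G.Adj (ord b) (p 0) := hcoladj hcolb
  set q : ℕ → V := fun i => if i ≤ 2 * j then p i else if i = 2 * j + 1 then z else ord b with hq
  have hqp : ∀ i, i ≤ 2 * j → q i = p i := fun i hi => by simp [hq, hi]
  have hqz : q (2 * j + 1) = z := by simp [hq]
  have hqb : q (2 * (j + 1)) = ord b := by simp [hq, show ¬ 2 * (j + 1) ≤ 2 * j by omega]; omega
  have hqind : G.IsInducedPath q (2 * (j + 1)) := by
    intro i l hil hl
    by_cases hlj : l ≤ 2 * j
    · rw [hqp i (by omega), hqp l hlj, hind i l hil (by omega)]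
    · by_cases hl1 : l = 2 * j + 1
      · rw [hl1, hqz, hqp i (by omega)]
        by_cases hi : i = 2 * j
        · subst hi; simp [hjz]
        · have : ¬ G.Adj (p i) z := by
            by_cases hi0 : i = 0
            · rwa [hi0]
            · exact hzp i (by omega) (by omega)
          simp only [this, false_iff]; omega
      · obtain rfl : l = 2 * (j + 1) := by omega
        rw [hqb]
        by_cases hi1 : i = 2 * j + 1
        · simp [hi1, hqz, hbz.symm]; omega
        · have : ¬ G.Adj (p i) (ord b) := by
            rw [G.adj_comm]
            by_cases hi0 : i = 0
            · rwa [hi0]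
            · by_cases hi1 : i = 1
              · rwa [hi1]
              · exact hbp i (by omega) (by omega)
          rw [hqp i (by omega)]
          simp only [this, false_iff]; omega
  -- The later of `a` and `b` becomes the new right end, so the path is reversed if `b < a`.
  -- Equality is impossible, since `ord b` is adjacent to `z` and `p 0` is not.
  rcases lt_trichotomy a b with hab | hab | hab
  · refine ⟨a, b, j + 1, q, hb, hab, by omega, by rw [hqp 0 (by omega), hleft], hqb, hqind,
      by rwa [hqp 1 (by omega)], ?_⟩
    intro i h1 h2 l hl
    by_cases hi : i = j
    · rw [hi, hqz]; exact hbmin l hl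
    · rw [hqp _ (by omega)]; exact hlate i h1 (by omega) l (by omega)
  · exact absurd (hleft ▸ hab ▸ hbz) h0z
  · refine ⟨b, a, j + 1, fun i => q (2 * (j + 1) - i), hac, hab, by omega, by simp [hqb],
      by simp [hqp 0, hleft], hqind.reverse, ?_, ?_⟩
    · simpa [show 2 * (j + 1) - 1 = 2 * j + 1 by omega, hqz] using hbmin
    · intro i h1 h2 l hl
      rw [hqp _ (by omega), show 2 * (j + 1) - (2 * i + 1) = 2 * (j - i) + 1 by omega]
      by_cases hi : i = j
      · subst hi; simpa using hfirst l hl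
      · exact hlate _ (by omega) (by omega) l (by omega)

theorem IsChordalBipartite.not_isLatePath (hG : G.IsChordalBipartite) {ord : ℕ → V} {n : ℕ}
    (hord : G.IsMaxSearchOrder ord n) (c : ℕ) (hc : c < n) (a k : ℕ) (p : ℕ → V) :
    ¬ G.IsLatePath ord a c k p := by
  induction c using Nat.strong_induction_on generalizing a k p with
  | _ c ih =>
    intro hp
    obtain ⟨a', c', k', p', hlt, hp'⟩ := hG.exists_latePath_lt hord hc hp
    exact ih c' hlt (hlt.trans hc) a' k' p' hp'

/-- If `y` and `y'` have a common neighbor, then the later one of their first neighbors is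
adjacent to both of them. -/
theorem IsChordalBipartite.adj_of_isFirstNeighbor (hG : G.IsChordalBipartite) {ord : ℕ → V}
    {n : ℕ} (hord : G.IsMaxSearchOrder ord n) {a c : ℕ} {x y y' : V} (hc : c < n) (hac : a ≤ c)
    (hy' : G.IsFirstNeighbor ord a y') (hy : G.IsFirstNeighbor ord c y)
    (hxy : G.Adj x y) (hxy' : G.Adj x y') : G.Adj (ord c) y' := by
  by_contra hn
  have hac : a < c := by
    refine lt_of_le_of_ne hac ?_
    rintro rfl
    exact hn hy'.1
  have col : G.Coloring Bool := G.recolorOfEquiv finTwoEquiv hG.1.some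
  have hbool : ∀ {p q r : Bool}, p ≠ q → q ≠ r → p = r := by decide
  have hcoladj : ∀ {u v}, col u = col v → ¬ G.Adj u v := fun h h' => col.valid h' h
  have hax : ¬ G.Adj (ord a) x := hcoladj (hbool (col.valid hy'.1) (col.valid hxy'.symm))
  have hyy : ¬ G.Adj y' y := hcoladj (hbool (col.valid hxy'.symm) (col.valid hxy))
  have hxc : ¬ G.Adj x (ord c) := hcoladj (hbool (col.valid hxy) (col.valid hy.1.symm))
  have haa : ¬ G.Adj (ord a) (ord c) := hcoladj
    ((hbool (col.valid hy'.1) (col.valid hxy'.symm)).trans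
      (hbool (col.valid hxy) (col.valid hy.1.symm)))
  -- If `ord c` missed `y'`, then `ord a, y', x, y, ord c` would be a late path: bipartiteness
  -- excludes the chords between vertices of the same side, and `y` has no neighbor before `ord c`.
  refine hG.not_isLatePath hord c hc a 2 (fun i => if i = 0 then ord a else if i = 1 then y'
    else if i = 2 then x else if i = 3 then y else ord c)
    ⟨hac, le_rfl, by simp, by simp, ?_, by simpa using hy'.2, ?_⟩
  · intro i j hij hj
    have hay := hy.2 a hac
    rw [G.adj_comm] at hn
    interval_cases j <;> interval_cases i <;>
      simp [hax, haa, hyy, hxc, hay, hn, hxy, hxy'.symm, hy.1.symm, hy'.1]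
  · intro i h1 h2
    obtain rfl : i = 1 := by omega
    simpa using hy.2

end SimpleGraph

/-! ### Memory layout and the subroutines of the search. -/

namespace WordRAM

@[simp] theorem State.setReg_reg (s : State) (x a y : ℕ) :
    (s.setReg x a).reg y = if y = x then a else s.reg y := by
  simp [State.setReg, Function.update_apply]

@[simp] theorem State.setReg_mem (s : State) (x a : ℕ) : (s.setReg x a).mem = s.mem := rfl

@[simp] theorem State.setMem_reg (s : State) (a b : ℕ) : (s.setMem a b).reg = s.reg := rfl

@[simp] theorem State.setMem_mem (s : State) (a b c : ℕ) :
    (s.setMem a b).mem c = if c = a then b else s.mem c := by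
  simp [State.setMem, Function.update_apply]

attribute [simp] Halts.skip_iff Halts.const_iff Halts.move_iff Halts.add_iff Halts.sub_iff
  Halts.load_iff Halts.store_iff Halts.seq_iff Halts.ite_iff

open Classical in
/-- The working environment: constants in the registers `0, 2, …, 6`, and the adjacency matrix. -/
structure Env (H : SimpleGraph ℕ) (n : ℕ) (s : State) : Prop where
  size : s.reg 0 = n
  one : s.reg 2 = 1
  count : s.reg 3 = n * n
  visited : s.reg 4 = n * n + n
  first : s.reg 5 = n * n + 2 * n
  order : s.reg 6 = n * n + 3 * n
  adj : ∀ i < n, ∀ j < n, s.mem (i * n + j) = if H.Adj i j then 1 else 0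

theorem mul_add_lt_mul_self {n i j : ℕ} (hi : i < n) (hj : j < n) : i * n + j < n * n := by
  nlinarith

/-- The working data lie outside the protected region: registers `3` to `6` hold the base addresses
of four arrays of length `n` that follow the matrix, namely the counters, the visited flags, the
labels (index of the first neighbor plus one) and the order. -/
theorem Env.congr {H : SimpleGraph ℕ} {n : ℕ} {s s' : State} (h : Env H n s)
    (hr : ∀ r < 7, s'.reg r = s.reg r) (hm : ∀ a < n * n, s'.mem a = s.mem a) : Env H n s' := by
  obtain ⟨h0, h2, h3, h4, h5, h6, ha⟩ := h
  refine ⟨?_, ?_, ?_, ?_, ?_, ?_, fun i hi j hj => ?_⟩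
  · rw [hr 0 (by norm_num), h0]
  · rw [hr 2 (by norm_num), h2]
  · rw [hr 3 (by norm_num), h3]
  · rw [hr 4 (by norm_num), h4]
  · rw [hr 5 (by norm_num), h5]
  · rw [hr 6 (by norm_num), h6]
  · rw [hm _ (mul_add_lt_mul_self hi hj), ha i hi j hj]

/-- Compute the constants of the working environment. -/
def setup : Program :=
  .seq (.const 2 1) <| .seq (.move 9 0) <| .seq (.const 3 0) <|
  .seq (.while 9 (.seq (.add 3 3 0) (.sub 9 9 2))) <|
  .seq (.add 4 3 0) <| .seq (.add 5 4 0) (.add 6 5 0)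

/-- The machine cannot multiply, so `n * n` is obtained by `n` additions. For the same reason later
loops carry row addresses along, and the order is stored as row addresses `ord l * n`. -/
theorem halts_setup {n W : ℕ} {s₀ : State} (hW : n * n + 4 * n + 2 ≤ W) (h0 : s₀.reg 0 = n) :
    Halts W setup (fun t s => t ≤ 3 * n + 10 ∧ s.reg 0 = n ∧ s.reg 1 = s₀.reg 1 ∧ s.reg 2 = 1 ∧
      s.reg 3 = n * n ∧ s.reg 4 = n * n + n ∧ s.reg 5 = n * n + 2 * n ∧
      s.reg 6 = n * n + 3 * n ∧ s.mem = s₀.mem) s₀ := by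
  simp only [setup, Halts.seq_iff, Halts.const_iff, Halts.move_iff]
  refine ⟨by omega, by omega, Halts.while_of_invariant (m := n)
    (fun j t s => t ≤ 3 * j ∧ s.reg 0 = n ∧ s.reg 1 = s₀.reg 1 ∧ s.reg 2 = 1 ∧ s.reg 3 = j * n ∧
      s.reg 9 = n - j ∧ s.mem = s₀.mem) ?_ ?_ ?_ ?_⟩
  · simp [h0]
  · rintro j t s ⟨-, -, -, -, -, h, -⟩
    exact h
  · rintro j t s hj ⟨ht, r0, r1, r2, r3, r9, hm⟩
    have : j * n + n ≤ n * n := by nlinarith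
    simp [r0, r1, r2, r3, r9, hm]
    refine ⟨by omega, by omega, by ring, by omega⟩
  · rintro t s ⟨ht, r0, r1, r2, r3, r9, hm⟩
    simp [r0, r1, r2, r3, hm]
    omega

/-- Increment the counters of all neighbors of the vertex whose row starts at the address in
register `14`. -/
def incrementNeighbors : Program :=
  .seq (.const 19 0) <| .seq (.move 20 0) <| .while 20 <|
  .seq (.add 21 14 19) <| .seq (.load 21 21) <| .seq (.add 22 3 19) <| .seq (.load 23 22) <|
  .seq (.add 23 23 21) <| .seq (.store 22 23) <| .seq (.add 19 19 2) (.sub 20 20 2)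

open Classical in
theorem halts_incrementNeighbors {H : SimpleGraph ℕ} {n W y : ℕ} {s₀ : State}
    (hW : n * n + 4 * n + 2 ≤ W) (he : Env H n s₀) (hy : y < n) (h14 : s₀.reg 14 = y * n)
    (hcnt : ∀ x < n, s₀.mem (n * n + x) ≤ n) :
    Halts W incrementNeighbors (fun t s => t ≤ 9 * n + 3 ∧ (∀ r < 19, s.reg r = s₀.reg r) ∧
      ∀ a, s.mem a = s₀.mem a +
        if n * n ≤ a ∧ a < n * n + n ∧ H.Adj y (a - n * n) then 1 else 0) s₀ := by
  simp only [incrementNeighbors, Halts.seq_iff, Halts.const_iff, Halts.move_iff]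
  refine ⟨by omega, Halts.while_of_invariant (m := n)
    (fun j t s => t ≤ 9 * j ∧ s.reg 19 = j ∧ s.reg 20 = n - j ∧ (∀ r < 19, s.reg r = s₀.reg r) ∧
      ∀ a, s.mem a = s₀.mem a +
        if n * n ≤ a ∧ a < n * n + j ∧ H.Adj y (a - n * n) then 1 else 0) ?_ ?_ ?_ ?_⟩
  · have h0 := he.size
    simp only [State.setReg_reg, State.setReg_mem]
    refine ⟨le_rfl, by simp, by simp [h0], fun r hr => ?_, fun a => ?_⟩
    · simp [show r ≠ 19 by omega, show r ≠ 20 by omega]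
    · simp; omega
  · rintro j t s ⟨-, -, h, -, -⟩
    exact h
  · rintro j t s hj ⟨ht, r19, r20, hr, hm⟩
    have he' : Env H n s := he.congr (fun r h => hr r (by omega)) fun a ha => by
      rw [hm]; simp; omega
    have hlt := mul_add_lt_mul_self hy hj
    have hadj := he'.adj y hy j hj
    have hc : s.mem (n * n + j) = s₀.mem (n * n + j) := by rw [hm]; simp
    have hcj := hcnt j hj
    have hb : (if H.Adj y j then 1 else 0 : ℕ) ≤ 1 := by split_ifs <;> simp
    simp [r19, r20, hr 14, h14, he'.count, he'.one, hadj, hc]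
    refine ⟨by omega, by omega, by omega, by omega, by omega, by omega, fun r h => ?_, fun a => ?_⟩
    · simp [show r ≠ 19 by omega, show r ≠ 20 by omega, show r ≠ 21 by omega,
        show r ≠ 22 by omega, show r ≠ 23 by omega, hr r h]
    · by_cases ha : a = n * n + j
      · subst ha; simp
      · rw [if_neg ha, hm]
        congr 2
        apply propext
        constructor
        · rintro ⟨h1, h2, h3⟩; exact ⟨h1, by omega, h3⟩
        · rintro ⟨h1, h2, h3⟩; exact ⟨h1, by omega, h3⟩
  · rintro t s ⟨ht, r19, r20, hr, hm⟩
    exact ⟨by omega, hr, hm⟩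

/-- Find an unvisited vertex with the largest counter: its number is written into register `11`,
and the address of its row into register `12`. -/
def selectMax : Program :=
  .seq (.const 16 0) <| .seq (.const 13 0) <| .seq (.const 14 0) <| .seq (.move 15 0) <|
  .while 15 <|
  .seq (.add 17 4 13) <| .seq (.load 17 17) <|
  .seq (.ite 17 .skip <|
    .seq (.add 17 3 13) <| .seq (.load 17 17) <| .seq (.add 17 17 2) <| .seq (.sub 18 17 16) <|
    .ite 18 (.seq (.move 16 17) <| .seq (.move 11 13) <| .move 12 14) .skip) <|
  .seq (.add 13 13 2) <| .seq (.add 14 14 0) <| .sub 15 15 2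

theorem halts_selectMax {H : SimpleGraph ℕ} {n W : ℕ} {s₀ : State}
    (hW : n * n + 4 * n + 2 ≤ W) (he : Env H n s₀) (hcnt : ∀ x < n, s₀.mem (n * n + x) ≤ n)
    (hun : ∃ v < n, s₀.mem (n * n + n + v) = 0) :
    Halts W selectMax (fun t s => t ≤ 15 * n + 5 ∧ (∀ r < 11, s.reg r = s₀.reg r) ∧
      s.mem = s₀.mem ∧ ∃ v < n, s.reg 11 = v ∧ s.reg 12 = v * n ∧
        s₀.mem (n * n + n + v) = 0 ∧ ∀ u < n, s₀.mem (n * n + n + u) = 0 →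
          s₀.mem (n * n + u) ≤ s₀.mem (n * n + v)) s₀ := by
  simp only [selectMax, Halts.seq_iff (p := .const _ _), Halts.seq_iff (p := .move _ _),
    Halts.const_iff, Halts.move_iff]
  -- Register `16` holds the best counter plus one, so that `0` means that no unvisited vertex has
  -- been seen and even a counter `0` beats it.
  refine ⟨by omega, by omega, by omega, Halts.while_of_invariant (m := n)
    (fun j t s => t ≤ 15 * j ∧ s.reg 13 = j ∧ s.reg 14 = j * n ∧ s.reg 15 = n - j ∧
      (∀ r < 11, s.reg r = s₀.reg r) ∧ s.mem = s₀.mem ∧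
      (∀ u < j, s₀.mem (n * n + n + u) = 0 → s₀.mem (n * n + u) + 1 ≤ s.reg 16) ∧
      (s.reg 16 = 0 ∨ s.reg 11 < n ∧ s.reg 12 = s.reg 11 * n ∧
        s₀.mem (n * n + n + s.reg 11) = 0 ∧ s.reg 16 = s₀.mem (n * n + s.reg 11) + 1)) ?_ ?_ ?_ ?_⟩
  · have h0 := he.size
    simp [h0]
    intro r hr
    simp [show r ≠ 13 by omega, show r ≠ 14 by omega, show r ≠ 15 by omega, show r ≠ 16 by omega]
  · rintro j t s ⟨-, -, -, h, -⟩
    exact h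
  · rintro j t s hj ⟨ht, r13, r14, r15, hr, hm, hmax, hbest⟩
    have he' : Env H n s := he.congr (fun r h => hr r (by omega)) fun a ha => by rw [hm]
    have hcj := hcnt j hj
    have hjn : j * n + n ≤ n * n := by nlinarith
    have hne : ∀ r < 11, r ≠ 11 ∧ r ≠ 12 ∧ r ≠ 13 ∧ r ≠ 14 ∧ r ≠ 15 ∧ r ≠ 16 ∧ r ≠ 17 ∧ r ≠ 18 := by
      omega
    have hsucc : (j + 1) * n = j * n + n := by ring
    simp only [Halts.seq_iff, Halts.add_iff, Halts.load_iff, Halts.ite_iff, Halts.skip_iff,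
      Halts.sub_iff, Halts.move_iff]
    simp only [State.setReg_reg, State.setReg_mem, hm, r13, r14, r15, he'.count, he'.visited,
      he'.one, he'.size]
    simp
    refine ⟨by omega, fun hv => ⟨by omega, by omega, by omega, by omega, by omega, ?_, ?_, ?_⟩,
      fun hv => ⟨by omega, by omega, fun hlt => ?_, fun hle => ?_⟩⟩
    · intro r h; simp [hne r h, hr r h]
    · intro u hu hu0
      rcases hu.lt_or_eq with h | rfl
      · exact hmax u h hu0
      · exact absurd hu0 hv
    · exact hbest
    · refine ⟨by omega, by omega, by omega, by omega, by omega, ?_, ?_, ?_⟩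
      · intro r h; simp [hne r h, hr r h]
      · intro u hu hu0
        rcases hu.lt_or_eq with h | rfl
        · have := hmax u h hu0; omega
        · omega
      · exact ⟨hj, hv⟩
    · refine ⟨by omega, by omega, by omega, by omega, by omega, ?_, ?_, ?_⟩
      · intro r h; simp [hne r h, hr r h]
      · intro u hu hu0
        rcases hu.lt_or_eq with h | rfl
        · exact hmax u h hu0
        · omega
      · exact hbest
  · rintro t s ⟨ht, -, -, -, hr, hm, hmax, hbest⟩
    refine ⟨by omega, hr, hm, ?_⟩
    obtain ⟨w, hw, hw0⟩ := hun
    have h1 := hmax w hw hw0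
    rcases hbest with h | ⟨hv, h12, hv0, hb⟩
    · omega
    · refine ⟨_, hv, rfl, h12, hv0, fun u hu hu0 => ?_⟩
      have := hmax u hu hu0
      omega

/-- Visit the vertex whose row starts at the address in register `12`: each neighbor without a
first neighbor gets the number in register `9`, and the counters are updated. -/
def visit : Program :=
  .seq (.const 13 0) <| .seq (.const 14 0) <| .seq (.move 15 0) <| .while 15 <|
  .seq (.add 16 12 13) <| .seq (.load 16 16) <|
  .seq (.ite 16
    (.seq (.add 17 5 13) <| .seq (.load 18 17) <|
      .ite 18 .skip (.seq (.store 17 9) incrementNeighbors))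
    .skip) <|
  .seq (.add 13 13 2) <| .seq (.add 14 14 0) <| .sub 15 15 2

-- The time bound is amortized with potential `(9 * n + 9)` times the number of reached vertices:
-- scanning the row of `v` is linear, and each linear-time counter update is paid for by the vertex
-- that becomes reached. `M` is the set of vertices reached before the visit, and each counter holds
-- the number of neighbors in the current reached set.
open Classical in
theorem halts_visit {H : SimpleGraph ℕ} {n W v m : ℕ} {s₀ : State} {M : Finset ℕ}
    (hW : n * n + 4 * n + 2 ≤ W) (he : Env H n s₀) (hv : v < n) (h9 : s₀.reg 9 = m + 1)
    (h12 : s₀.reg 12 = v * n) (hM : M ⊆ Finset.range n)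
    (hfirst : ∀ y < n, s₀.mem (n * n + 2 * n + y) = 0 ↔ y ∉ M)
    (hcnt : ∀ x < n, s₀.mem (n * n + x) = (M.filter (H.Adj x)).card) :
    Halts W visit (fun t s =>
      t + (9 * n + 9) * M.card ≤
        11 * n + 4 + (9 * n + 9) * (M ∪ (Finset.range n).filter (H.Adj v)).card ∧
      (∀ r < 13, s.reg r = s₀.reg r) ∧
      (∀ a, (a < n * n ∨ n * n + n ≤ a ∧ a < n * n + 2 * n ∨ n * n + 3 * n ≤ a) →
        s.mem a = s₀.mem a) ∧
      (∀ y < n, s.mem (n * n + 2 * n + y) = if s₀.mem (n * n + 2 * n + y) = 0 ∧ H.Adj v y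
        then m + 1 else s₀.mem (n * n + 2 * n + y)) ∧
      ∀ x < n, s.mem (n * n + x) =
        ((M ∪ (Finset.range n).filter (H.Adj v)).filter (H.Adj x)).card) s₀ := by
  simp only [visit, Halts.seq_iff (p := .const _ _), Halts.seq_iff (p := .move _ _),
    Halts.const_iff, Halts.move_iff]
  refine ⟨by omega, by omega, Halts.while_of_invariant (m := n)
    (fun j t s => t + (9 * n + 9) * M.card ≤
        11 * j + (9 * n + 9) * (M ∪ (Finset.range j).filter (H.Adj v)).card ∧
      s.reg 13 = j ∧ s.reg 14 = j * n ∧ s.reg 15 = n - j ∧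
      (∀ r < 13, s.reg r = s₀.reg r) ∧
      (∀ a, (a < n * n ∨ n * n + n ≤ a ∧ a < n * n + 2 * n ∨ n * n + 3 * n ≤ a) →
        s.mem a = s₀.mem a) ∧
      (∀ y < n, s.mem (n * n + 2 * n + y) = if y < j ∧ s₀.mem (n * n + 2 * n + y) = 0 ∧ H.Adj v y
        then m + 1 else s₀.mem (n * n + 2 * n + y)) ∧
      ∀ x < n, s.mem (n * n + x) =
        ((M ∪ (Finset.range j).filter (H.Adj v)).filter (H.Adj x)).card) ?_ ?_ ?_ ?_⟩
  · have h0 := he.size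
    simp [h0]
    refine ⟨fun r hr => ?_, hcnt⟩
    simp [show r ≠ 13 by omega, show r ≠ 14 by omega, show r ≠ 15 by omega]
  · rintro j t s ⟨-, -, -, h, -⟩
    exact h
  · rintro j t s hj ⟨ht, r13, r14, r15, hr, hm, hF, hC⟩
    have he' : Env H n s := he.congr (fun r h => hr r (by omega)) fun a ha => hm a (.inl ha)
    have hlt := mul_add_lt_mul_self hv hj
    have hjn : j * n + n ≤ n * n := by nlinarith
    have hsucc : (j + 1) * n = j * n + n := by ring
    have hadj := he'.adj v hv j hj
    have hFj := hF j hj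
    simp only [lt_self_iff_false, false_and, if_false] at hFj
    have hne : ∀ r < 13, r ≠ 13 ∧ r ≠ 14 ∧ r ≠ 15 ∧ r ≠ 16 ∧ r ≠ 17 ∧ r ≠ 18 := by omega
    have hlt' : ∀ y, y ≠ j → (y < j + 1 ↔ y < j) := by omega
    have hMn : ∀ x, ((M ∪ (Finset.range j).filter (H.Adj v)).filter (H.Adj x)).card ≤ n := by
      intro x
      refine (Finset.card_le_card ?_).trans (Finset.card_range n).le
      intro y hy
      simp only [Finset.mem_filter, Finset.mem_union, Finset.mem_range] at hy ⊢
      rcases hy.1 with h | h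
      · exact Finset.mem_range.1 (hM h)
      · omega
    simp only [Halts.seq_iff, Halts.add_iff, Halts.load_iff, Halts.ite_iff, Halts.skip_iff,
      Halts.sub_iff, Halts.store_iff]
    simp only [State.setReg_reg, State.setReg_mem, r13, r14, r15, he'.first, hr 12, h12,
      he'.one, he'.size, hadj, hFj, Nat.reduceEqDiff, if_true, if_false, Nat.reduceLT]
    by_cases hvj : H.Adj v j
    · have hrange : M ∪ (Finset.range (j + 1)).filter (H.Adj v) =
          insert j (M ∪ (Finset.range j).filter (H.Adj v)) := by
        rw [Finset.range_add_one, Finset.filter_insert, if_pos hvj, Finset.union_insert]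
      rw [hrange]
      simp only [hvj, if_true]
      by_cases hj0 : s₀.mem (n * n + 2 * n + j) = 0
      · have hjM : j ∉ M ∪ (Finset.range j).filter (H.Adj v) := by
          simp [(hfirst j hj).1 hj0]
        refine ⟨by omega, fun _ => ⟨by omega, fun h => absurd hj0 h, fun _ => ?_⟩,
          fun h => absurd h one_ne_zero⟩
        refine (halts_incrementNeighbors (H := H) (y := j) hW ?_ hj ?_ ?_).mono ?_
        · refine he'.congr (fun r h => ?_) fun a ha => ?_
          · simp [hne r (by omega)]
          · simp; omega
        · simp [r14]
        · intro x hx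
          simp [show n * n + x ≠ n * n + 2 * n + j by omega, hC x hx, hMn x]
        · rintro t' s' ⟨ht', hr', hm'⟩
          simp at hr' hm' ⊢
          have r13' : s'.reg 13 = j := by rw [hr' 13 (by omega)]; simp [r13]
          have r14' : s'.reg 14 = j * n := by rw [hr' 14 (by omega)]; simp [r14]
          have r15' : s'.reg 15 = n - j := by rw [hr' 15 (by omega)]; simp [r15]
          have r2' : s'.reg 2 = 1 := by rw [hr' 2 (by omega)]; simp [he'.one]
          have r0' : s'.reg 0 = n := by rw [hr' 0 (by omega)]; simp [he'.size]
          simp [r13', r14', r15', r2', r0']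
          -- The new vertex `j` raises the potential by `9 * n + 9`, which pays for
          -- `incrementNeighbors`.
          refine ⟨by omega, by omega, ?_, by omega, by omega, ?_, ?_, ?_, ?_⟩
          · rw [Finset.card_insert_of_notMem hjM]
            linarith
          · intro r h
            rw [hr' r (by omega)]
            simp [hne r h, hr r h]
          · intro a ha
            rw [hm', if_neg (by omega), if_neg (by omega), hm a ha]
            rfl
          · intro y hy
            rw [hm', hF y hy, if_neg (by omega : ¬ (n * n ≤ n * n + 2 * n + y ∧
              n * n + 2 * n + y < n * n + n ∧ _))]
            by_cases hyj : y = j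
            · subst hyj; simp [hj0, hvj, hr 9, h9]
            · simp [hyj, ← hlt' y hyj]
          · intro x hx
            rw [hm', if_neg (by omega), hC x hx, Finset.filter_insert]
            simp only [Nat.le_add_right, add_lt_add_iff_left, hx, Nat.add_sub_cancel_left, true_and,
              H.adj_comm j x]
            split_ifs
            · rw [Finset.card_insert_of_notMem fun h => hjM (Finset.mem_of_mem_filter _ h)]
            · rfl
      · have hjM : j ∈ M := by
          by_contra h
          exact hj0 ((hfirst j hj).2 h)
        rw [Finset.insert_eq_of_mem (Finset.mem_union_left _ hjM)]
        refine ⟨by omega, fun _ => ⟨by omega, fun _ => ?_, fun h => absurd h hj0⟩,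
          fun h => absurd h one_ne_zero⟩
        simp
        refine ⟨by omega, by omega, by omega, by omega, by omega, ?_, hm, ?_, hC⟩
        · intro r h
          simp [hne r h, hr r h]
        · intro y hy
          by_cases hyj : y = j
          · subst hyj; simp [hj0, hFj]
          · simp [hF y hy, ← hlt' y hyj]
    · have hrange : M ∪ (Finset.range (j + 1)).filter (H.Adj v) =
          M ∪ (Finset.range j).filter (H.Adj v) := by
        rw [Finset.range_add_one, Finset.filter_insert, if_neg hvj]
      rw [hrange]
      simp only [hvj, if_false]
      refine ⟨by omega, fun h => absurd rfl h, fun _ => ?_⟩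
      simp
      refine ⟨by omega, by omega, by omega, by omega, by omega, ?_, hm, ?_, hC⟩
      · intro r h
        simp [hne r h, hr r h]
      · intro y hy
        by_cases hyj : y = j
        · subst hyj; simp [hvj, hFj]
        · simp [hF y hy, ← hlt' y hyj]
  · rintro t s ⟨ht, -, -, -, hr, hm, hF, hC⟩
    refine ⟨by omega, hr, hm, fun y hy => ?_, hC⟩
    rw [hF y hy]
    simp [hy]

end WordRAM

/-! ### First neighbors, and the greedy cover and packing. -/

namespace SimpleGraph

variable {H : SimpleGraph ℕ} {n : ℕ} {ord : ℕ → ℕ}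

theorem exists_isFirstNeighbor {i y : ℕ} (h : ∃ l < i, H.Adj (ord l) y) :
    ∃ l < i, H.IsFirstNeighbor ord l y := by
  classical
  refine ⟨Nat.find h, (Nat.find_spec h).1, (Nat.find_spec h).2, fun l hl ha => ?_⟩
  exact Nat.find_min h hl ⟨hl.trans (Nat.find_spec h).1, ha⟩

/-- `f y` is one more than the index of the first neighbor of `y` among `ord 0, …, ord (i - 1)`,
and `0` if there is none. -/
def IsFirstIndex (H : SimpleGraph ℕ) (n : ℕ) (ord : ℕ → ℕ) (i : ℕ) (f : ℕ → ℕ) : Prop :=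
  ∀ y < n, ∀ l, f y = l + 1 ↔ l < i ∧ H.IsFirstNeighbor ord l y

theorem IsFirstIndex.eq_zero_iff {f : ℕ → ℕ} {i y : ℕ} (hf : H.IsFirstIndex n ord i f)
    (hy : y < n) : f y = 0 ↔ ∀ l < i, ¬ H.Adj (ord l) y := by
  constructor
  · intro h l hl ha
    obtain ⟨l', hl', hfirst⟩ := exists_isFirstNeighbor ⟨l, hl, ha⟩
    have := (hf y hy l').2 ⟨hl', hfirst⟩
    omega
  · intro h
    by_contra h0
    obtain ⟨l, hl⟩ := Nat.exists_eq_succ_of_ne_zero h0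
    obtain ⟨hli, hla⟩ := (hf y hy l).1 hl
    exact h l hli hla.1

theorem IsFirstIndex.le {f : ℕ → ℕ} {i y : ℕ} (hf : H.IsFirstIndex n ord i f)
    (hy : y < n) : f y ≤ i := by
  rcases h : f y with - | l
  · simp
  · exact ((hf y hy l).1 h).1

/-- The part of a greedy cover `D` and of a greedy packing `P` that is built from the vertices
whose first neighbor has an index that is at least `i`. -/
structure IsGreedy (H : SimpleGraph ℕ) (n : ℕ) (f : ℕ → ℕ) (i c : ℕ) (D P : Finset ℕ) : Prop where
  card_le : D.card ≤ c
  le_card : c ≤ P.card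
  cover : ∀ y < n, i < f y → ∃ d ∈ D, H.Adj d y
  nonisolated : ∀ p ∈ P, ∃ x, H.Adj x p
  closed : ∀ p ∈ P, ∀ x y, H.Adj x p → H.Adj x y → ∃ d ∈ D, H.Adj d y
  packing : ∀ p ∈ P, ∀ q ∈ P, ∀ x, H.Adj x p → H.Adj x q → p = q

theorem IsGreedy.count_le {f : ℕ → ℕ} {i c : ℕ} {D P : Finset ℕ} (h : H.IsGreedy n f i c D P)
    (hlt : ∀ x y, H.Adj x y → y < n) : c ≤ n := by
  refine h.le_card.trans ((Finset.card_le_card fun p hp => ?_).trans (Finset.card_range n).le)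
  obtain ⟨x, hx⟩ := h.nonisolated p hp
  exact Finset.mem_range.2 (hlt x p hx)

/-- The heart of the duality: adding `ord i` covers every vertex that shares a neighbor with `p`.
This keeps `closed` true, and `closed` for the old packing is what makes the uncovered `p`
compatible with it. -/
theorem IsGreedy.pick (hH : H.IsChordalBipartite) (hlt : ∀ x y, H.Adj x y → y < n)
    (hord : H.IsMaxSearchOrder ord n) (hsurj : ∀ x < n, ∃ l < n, ord l = x) {f : ℕ → ℕ}
    (hf : H.IsFirstIndex n ord n f) {i c : ℕ} {D P : Finset ℕ}
    (h : H.IsGreedy n f (i + 1) c D P) {p : ℕ} (hp : p < n) (hfp : f p = i + 1)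
    (hpD : ∀ d ∈ D, ¬ H.Adj d p) :
    H.IsGreedy n f i (c + 1) (insert (ord i) D) (insert p P) := by
  obtain ⟨hin, hip⟩ := (hf p hp i).1 hfp
  have hclosed : ∀ x y, H.Adj x p → H.Adj x y → ∃ d ∈ insert (ord i) D, H.Adj d y := by
    intro x y hxp hxy
    have hy := hlt x y hxy
    by_cases hfy : i + 1 < f y
    · obtain ⟨d, hd, hdy⟩ := h.cover y hy hfy
      exact ⟨d, Finset.mem_insert_of_mem hd, hdy⟩
    -- The first neighbor of `y` is not later than `ord i`, so `ord i` is the later one for the pair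
    -- `p`, `y`.
    · refine ⟨ord i, Finset.mem_insert_self _ _, ?_⟩
      obtain ⟨l, hl, rfl⟩ := hsurj x (hlt y x hxy.symm)
      obtain ⟨a, ha, hay⟩ := exists_isFirstNeighbor ⟨l, hl, hxy⟩
      have := (hf y hy a).2 ⟨ha, hay⟩
      exact hH.adj_of_isFirstNeighbor hord hin (by omega) hay hip hxp hxy
  have hpP : ∀ q ∈ P, ∀ x, H.Adj x q → H.Adj x p → False := by
    intro q hq x hxq hxp
    obtain ⟨d, hd, hdp⟩ := h.closed q hq x p hxq hxp
    exact hpD d hd hdp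
  refine ⟨(Finset.card_insert_le _ _).trans (Nat.succ_le_succ h.card_le), ?_, ?_, ?_, ?_, ?_⟩
  -- `p` is new: a member of the packing shares a neighbor with itself, so it is covered by
  -- `closed`.
  · rw [Finset.card_insert_of_notMem fun hpm => hpP p hpm _ hip.1 hip.1]
    exact Nat.succ_le_succ h.le_card
  · intro y hy hfy
    by_cases hfy' : f y = i + 1
    · exact ⟨ord i, Finset.mem_insert_self _ _, ((hf y hy i).1 hfy').2.1⟩
    · obtain ⟨d, hd, hdy⟩ := h.cover y hy (by omega)
      exact ⟨d, Finset.mem_insert_of_mem hd, hdy⟩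
  · intro q hq
    rcases Finset.mem_insert.1 hq with rfl | hq
    · exact ⟨_, hip.1⟩
    · exact h.nonisolated q hq
  · intro q hq x y hxq hxy
    rcases Finset.mem_insert.1 hq with rfl | hq
    · exact hclosed x y hxq hxy
    · obtain ⟨d, hd, hdy⟩ := h.closed q hq x y hxq hxy
      exact ⟨d, Finset.mem_insert_of_mem hd, hdy⟩
  · intro q hq r hr x hxq hxr
    rcases Finset.mem_insert.1 hq with rfl | hq' <;> rcases Finset.mem_insert.1 hr with rfl | hr'
    · rfl
    · exact (hpP r hr' x hxr hxq).elim
    · exact (hpP q hq' x hxq hxr).elim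
    · exact h.packing q hq' r hr' x hxq hxr

theorem IsGreedy.skip {f : ℕ → ℕ} {i c : ℕ} {D P : Finset ℕ} (h : H.IsGreedy n f (i + 1) c D P)
    (hno : ∀ y < n, f y = i + 1 → ∃ d ∈ D, H.Adj d y) : H.IsGreedy n f i c D P :=
  { h with
    cover := fun y hy hfy => by
      by_cases hfy' : f y = i + 1
      · exact hno y hy hfy'
      · exact h.cover y hy (by omega) }

open Classical in
/-- The vertices with a neighbor among `ord 0, …, ord (i - 1)`. -/
noncomputable def reached (H : SimpleGraph ℕ) (n : ℕ) (ord : ℕ → ℕ) (i : ℕ) : Finset ℕ :=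
  (Finset.range n).filter fun y => ∃ l < i, H.Adj (ord l) y

theorem mem_reached {i y : ℕ} : y ∈ H.reached n ord i ↔ y < n ∧ ∃ l < i, H.Adj (ord l) y := by
  simp [reached]

-- A counter maximum is also maximal under inclusion, which is all the descent argument needs: a set
-- cannot be properly contained in one that is not larger.
open Classical in
theorem exists_adj_not_adj_of_card_le {M : Finset ℕ} {v x y : ℕ}
    (hcard : (M.filter (H.Adj x)).card ≤ (M.filter (H.Adj v)).card)
    (hy : y ∈ M) (hxy : H.Adj x y) (hvy : ¬ H.Adj v y) : ∃ z ∈ M, H.Adj v z ∧ ¬ H.Adj x z := by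
  by_contra! hcon
  refine absurd hcard (not_le.2 (Finset.card_lt_card ⟨fun z hz => ?_, fun hsub => ?_⟩))
  · rw [Finset.mem_filter] at hz ⊢
    exact ⟨hz.1, hcon z hz.1 hz.2⟩
  · exact hvy (Finset.mem_filter.1 (hsub (Finset.mem_filter.2 ⟨hy, hxy⟩))).2

end SimpleGraph

/-! ### Correctness and running time of the search. -/

namespace WordRAM

open SimpleGraph

/-- Order the vertices by a maximum cardinality search. -/
def search : Program :=
  .seq (.const 9 0) <| .seq (.move 10 0) <| .while 10 <|
  .seq selectMax <| .seq (.add 13 4 11) <| .seq (.store 13 2) <| .seq (.add 13 6 9) <|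
  .seq (.store 13 12) <| .seq (.add 9 9 2) <| .seq visit (.sub 10 10 2)

open Classical in
/-- The state after `i` rounds of the maximum cardinality search. -/
structure SearchState (H : SimpleGraph ℕ) (n : ℕ) (ord : ℕ → ℕ) (i : ℕ) (s : State) : Prop where
  env : Env H n s
  index : s.reg 9 = i
  counter : s.reg 10 = n - i
  ord_lt : ∀ l < i, ord l < n
  ord_inj : ∀ l < i, ∀ l' < i, ord l = ord l' → l = l'
  isMaxSearchOrder : H.IsMaxSearchOrder ord i
  order : ∀ l < i, s.mem (n * n + 3 * n + l) = ord l * n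
  visited : ∀ v < n, s.mem (n * n + n + v) = 0 ↔ ∀ l < i, ord l ≠ v
  first : H.IsFirstIndex n ord i fun y => s.mem (n * n + 2 * n + y)
  count : ∀ x < n, s.mem (n * n + x) = ((H.reached n ord i).filter (H.Adj x)).card

theorem SearchState.exists_unvisited {H : SimpleGraph ℕ} {n i : ℕ} {ord : ℕ → ℕ} {s : State}
    (h : SearchState H n ord i s) (hi : i < n) : ∃ v < n, s.mem (n * n + n + v) = 0 := by
  classical
  have hcard : ((Finset.range i).image ord).card < (Finset.range n).card :=
    Finset.card_image_le.trans_lt (by simpa using hi)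
  obtain ⟨v, hv, hv'⟩ := Finset.exists_mem_notMem_of_card_lt_card hcard
  refine ⟨v, Finset.mem_range.1 hv, (h.visited v (Finset.mem_range.1 hv)).2 fun l hl hlv => ?_⟩
  exact hv' (Finset.mem_image.2 ⟨l, Finset.mem_range.2 hl, hlv⟩)

theorem SearchState.surjective {H : SimpleGraph ℕ} {n : ℕ} {ord : ℕ → ℕ} {s : State}
    (h : SearchState H n ord n s) : ∀ x < n, ∃ l < n, ord l = x := by
  classical
  have himage : (Finset.range n).image ord = Finset.range n := by
    refine Finset.eq_of_subset_of_card_le ?_ ?_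
    · intro x hx
      obtain ⟨l, hl, rfl⟩ := Finset.mem_image.1 hx
      exact Finset.mem_range.2 (h.ord_lt l (Finset.mem_range.1 hl))
    · rw [Finset.card_image_of_injOn]
      intro l hl l' hl' heq
      exact h.ord_inj l (by simpa using hl) l' (by simpa using hl') heq
  intro x hx
  obtain ⟨l, hl, hlx⟩ := Finset.mem_image.1 (himage ▸ Finset.mem_range.2 hx)
  exact ⟨l, Finset.mem_range.1 hl, hlx⟩

theorem halts_search_round {H : SimpleGraph ℕ} {n W i : ℕ} {ord : ℕ → ℕ} {s₀ : State}
    (hW : n * n + 4 * n + 2 ≤ W) (hlt : ∀ x y, H.Adj x y → y < n) (hi : i < n)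
    (h : SearchState H n ord i s₀) :
    Halts W (.seq selectMax <| .seq (.add 13 4 11) <| .seq (.store 13 2) <| .seq (.add 13 6 9) <|
      .seq (.store 13 12) <| .seq (.add 9 9 2) <| .seq visit (.sub 10 10 2))
      (fun t s => s.reg 1 = s₀.reg 1 ∧ ∃ ord', SearchState H n ord' (i + 1) s ∧
        t + (9 * n + 9) * (H.reached n ord i).card ≤
          26 * n + 15 + (9 * n + 9) * (H.reached n ord' (i + 1)).card) s₀ := by
  classical
  have hMn : ∀ x, ((H.reached n ord i).filter (H.Adj x)).card ≤ n := fun x =>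
    (Finset.card_le_card ((Finset.filter_subset _ _).trans (Finset.filter_subset _ _))).trans
      (Finset.card_range n).le
  rw [Halts.seq_iff]
  refine (halts_selectMax hW h.env (fun x hx => ?_) (h.exists_unvisited hi)).mono ?_
  · rw [h.count x hx]
    exact hMn x
  rintro t s ⟨ht, hr, hm, v, hv, h11, h12, hv0, hmax⟩
  have he : Env H n s := h.env.congr (fun r h => hr r (by omega)) fun a ha => by rw [hm]
  have r9 : s.reg 9 = i := by rw [hr 9 (by norm_num), h.index]
  simp only [Halts.seq_iff, Halts.add_iff, Halts.store_iff, State.setReg_reg, State.setMem_reg,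
    he.visited, he.order, he.one, h11, h12, r9, Nat.reduceEqDiff, if_true,
    if_false]
  refine ⟨by omega, by omega, by omega, ?_⟩
  set ord' := Function.update ord i v with hord'
  have hold : ∀ l < i, ord' l = ord l := fun l hl => by simp [hord', hl.ne]
  have hnew : ord' i = v := by simp [hord']
  have hunv : ∀ l < i, ord l ≠ v := (h.visited v hv).1 hv0
  have hreach : H.reached n ord i ∪ (Finset.range n).filter (H.Adj v) =
      H.reached n ord' (i + 1) := by
    ext y
    simp only [Finset.mem_union, mem_reached, Finset.mem_filter, Finset.mem_range,
      Nat.exists_lt_succ_right, hnew]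
    have : (∃ l < i, H.Adj (ord' l) y) ↔ ∃ l < i, H.Adj (ord l) y :=
      exists_congr fun l => and_congr_right fun hl => by rw [hold l hl]
    rw [this, and_or_left]
  refine (halts_visit (M := H.reached n ord i) (v := v) (m := i) hW
    (he.congr (fun r h => ?_) fun a ha => ?_) hv ?_ ?_ (Finset.filter_subset _ _) ?_ ?_).mono ?_
  · simp [show r ≠ 9 by omega, show r ≠ 13 by omega]
  · simp [show a ≠ n * n + 3 * n + i by omega, show a ≠ n * n + n + v by omega]
  · simp
  · simp [h12]
  · intro y hy
    simp [show n * n + 2 * n + y ≠ n * n + 3 * n + i by omega,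
      show n * n + 2 * n + y ≠ n * n + n + v by omega, hm, h.first.eq_zero_iff hy, mem_reached, hy]
  · intro x hx
    simp [show n * n + x ≠ n * n + 3 * n + i by omega,
      show n * n + x ≠ n * n + n + v by omega, hm, h.count x hx]
  rintro t' s' ⟨ht', hr', hm', hF, hC⟩
  rw [hreach] at ht' hC
  simp at hr' hm' hF ⊢
  have hF' : ∀ y < n, s'.mem (n * n + 2 * n + y) =
      if s₀.mem (n * n + 2 * n + y) = 0 ∧ H.Adj v y then i + 1 else
        s₀.mem (n * n + 2 * n + y) := by
    intro y hy
    simp only [hF y hy, show n * n + 2 * n + y ≠ n * n + 3 * n + i by omega,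
      show n * n + 2 * n + y ≠ n * n + n + v by omega, if_false, hm]
  have r2' : s'.reg 2 = 1 := by rw [hr' 2 (by omega)]; simp [he.one]
  have r9' : s'.reg 9 = i + 1 := by rw [hr' 9 (by omega)]; simp
  have r10' : s'.reg 10 = n - i := by
    rw [hr' 10 (by omega)]; simp [hr 10, h.counter]
  refine ⟨?_, ord', ⟨?_, ?_, ?_, ?_, ?_, ?_, ?_, ?_, ?_, ?_⟩, ?_⟩
  · rw [hr' 1 (by omega)]; simp [hr 1]
  · refine he.congr (fun r h => ?_) fun a ha => ?_
    · simp [show r ≠ 10 by omega]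
      rw [hr' r (by omega)]
      simp [show r ≠ 9 by omega, show r ≠ 13 by omega]
    · simp
      rw [hm' a (by omega), if_neg (by omega), if_neg (by omega)]
  · simp [r9']
  · simp [r10', r2']; omega
  · intro l hl
    rcases (Nat.lt_succ_iff.1 hl).lt_or_eq with h1 | rfl
    · rw [hold l h1]; exact h.ord_lt l h1
    · rwa [hnew]
  · intro l hl l' hl' heq
    rcases (Nat.lt_succ_iff.1 hl).lt_or_eq with h1 | rfl <;>
      rcases (Nat.lt_succ_iff.1 hl').lt_or_eq with h2 | h2
    · rw [hold l h1, hold l' h2] at heq; exact h.ord_inj l h1 l' h2 heq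
    · rw [h2, hold l h1, hnew] at heq; exact absurd heq (hunv l h1)
    · rw [hnew, hold l' h2] at heq; exact absurd heq.symm (hunv l' h2)
    · exact h2.symm
  · intro l hl x hx
    have hl' : l ≤ i := Nat.lt_succ_iff.1 hl
    have hexists : ∀ y, (∃ r < l, H.Adj (ord' r) y) ↔ ∃ r < l, H.Adj (ord r) y := fun y =>
      exists_congr fun r => and_congr_right fun hr => by rw [hold r (by omega)]
    have hx' : ∀ r < l, ord r ≠ x := fun r hr => by rw [← hold r (by omega)]; exact hx r hr
    simp only [hexists]
    rcases hl'.lt_or_eq with h1 | rfl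
    · rw [hold l h1]
      exact h.isMaxSearchOrder l h1 x hx'
    · rw [hnew]
      rintro ⟨y, hy, hxy, hvy⟩
      have hxn := hlt y x hxy.symm
      -- Only the new position needs an argument: `v` has the largest counter among the unvisited
      -- vertices, and `x` is one of them.
      have hcard := hmax x hxn ((h.visited x hxn).2 hx')
      rw [h.count x hxn, h.count v hv] at hcard
      obtain ⟨z, hz, hvz, hxz⟩ := exists_adj_not_adj_of_card_le hcard
        (mem_reached.2 ⟨hlt x y hxy, hy⟩) hxy hvy
      exact ⟨z, (mem_reached.1 hz).2, hvz, hxz⟩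
  · intro l hl
    simp
    rw [hm' _ (by omega)]
    rcases (Nat.lt_succ_iff.1 hl).lt_or_eq with h1 | rfl
    · rw [if_neg (by omega), if_neg (by omega), hm, h.order l h1, hold l h1]
    · simp [hnew]
  · intro u hu
    have hall : (∀ l < i + 1, ord' l ≠ u) ↔ (∀ l < i, ord l ≠ u) ∧ v ≠ u := by
      rw [Nat.forall_lt_succ_right, hnew]
      exact and_congr_left fun _ => forall_congr' fun l => imp_congr_right fun hl => by
        rw [hold l hl]
    rw [hall, State.setReg_mem, hm' _ (by omega), if_neg (by omega)]
    simp only [add_right_inj]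
    by_cases huv : u = v
    · simp [huv]
    · simp [huv, hm, h.visited u hu, Ne.symm huv]
  · intro y hy l
    simp only [State.setReg_mem, hF' y hy]
    have hfirst : ∀ r ≤ i, H.IsFirstNeighbor ord' r y ↔
        H.Adj (ord' r) y ∧ ∀ q < r, ¬ H.Adj (ord q) y := fun r hr =>
      and_congr_right fun _ => forall_congr' fun q => imp_congr_right fun hq => by
        rw [hold q (by omega)]
    have hf := h.first y hy l
    have hf0 := h.first.eq_zero_iff hy
    simp only at hf hf0
    rcases lt_trichotomy l i with hl | rfl | hl
    · rw [hfirst l hl.le, hold l hl]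
      have : H.IsFirstNeighbor ord l y ↔ H.Adj (ord l) y ∧ ∀ q < l, ¬ H.Adj (ord q) y := Iff.rfl
      rw [← this]
      split_ifs with h0
      · simp only [h0.1] at hf
        constructor
        · omega
        · rintro ⟨-, h1⟩; exact absurd h1.1 (hf0.1 h0.1 l hl)
      · rw [hf]; simp [hl, hl.trans (Nat.lt_succ_self i)]
    · rw [hfirst l le_rfl, hnew, ← hf0]
      simp only [Nat.lt_succ_self, true_and]
      split_ifs with h0
      · simp [h0]
      · have : s₀.mem (n * n + 2 * n + y) ≤ l := h.first.le hy
        constructor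
        · omega
        · tauto
    · have : s₀.mem (n * n + 2 * n + y) ≤ i := h.first.le hy
      split_ifs <;> omega
  · intro x hx
    simp [hC x hx]
  · linarith

theorem halts_search {H : SimpleGraph ℕ} {n W : ℕ} {s₀ : State}
    (hW : n * n + 4 * n + 2 ≤ W) (hlt : ∀ x y, H.Adj x y → y < n) (he : Env H n s₀)
    (hzero : ∀ a, n * n ≤ a → s₀.mem a = 0) :
    Halts W search (fun t s => t ≤ 35 * (n * n) + 26 * n + 3 ∧ s.reg 1 = s₀.reg 1 ∧
      ∃ ord, SearchState H n ord n s) s₀ := by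
  classical
  simp only [search, Halts.seq_iff (p := .const _ _), Halts.seq_iff (p := .move _ _),
    Halts.const_iff, Halts.move_iff]
  refine ⟨by omega, Halts.while_of_invariant (m := n)
    (fun i t s => s.reg 1 = s₀.reg 1 ∧ ∃ ord, SearchState H n ord i s ∧
      t ≤ (26 * n + 16) * i + (9 * n + 9) * (H.reached n ord i).card) ?_ ?_ ?_ ?_⟩
  · refine ⟨by simp, fun _ => 0, ⟨?_, ?_, ?_, ?_, ?_, ?_, ?_, ?_, ?_, ?_⟩, by simp⟩
    · exact he.congr (fun r h => by simp [show r ≠ 9 by omega, show r ≠ 10 by omega])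
        fun a _ => rfl
    · simp
    · simp [he.size]
    · simp
    · simp
    · intro i hi; simp at hi
    · simp
    · intro v hv; simp [hzero (n * n + n + v) (by omega)]
    · intro y hy; simp [hzero (n * n + 2 * n + y) (by omega)]
    · intro x hx; simp [hzero, reached]
  · rintro i t s ⟨-, ord, h, -⟩
    exact h.counter
  · rintro i t s hi ⟨h1, ord, h, ht⟩
    refine (halts_search_round hW hlt hi h).mono ?_
    rintro t' s' ⟨h1', ord', h', ht'⟩
    refine ⟨h1'.trans h1, ord', h', ?_⟩
    linarith
  · rintro t s ⟨h1, ord, h, ht⟩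
    refine ⟨?_, h1, ord, h⟩
    -- At most `n` vertices are ever reached, so the total potential is quadratic.
    have hcard : (H.reached n ord n).card ≤ n :=
      (Finset.card_le_card (Finset.filter_subset _ _)).trans (Finset.card_range n).le
    nlinarith

/-! ### Isolated vertices and the greedy phase. -/

/-- Count the vertices without a first neighbor in register `8`. -/
def countIsolated : Program :=
  .seq (.const 8 0) <| .seq (.const 13 0) <| .seq (.move 15 0) <| .while 15 <|
  .seq (.add 16 5 13) <| .seq (.load 16 16) <| .seq (.ite 16 .skip (.add 8 8 2)) <|
  .seq (.add 13 13 2) (.sub 15 15 2)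

theorem halts_countIsolated {H : SimpleGraph ℕ} {n W : ℕ} {s₀ : State}
    (hW : n * n + 4 * n + 2 ≤ W) (he : Env H n s₀) :
    Halts W countIsolated (fun t s => t ≤ 7 * n + 4 ∧
      (∀ r < 13, r ≠ 8 → s.reg r = s₀.reg r) ∧ s.mem = s₀.mem ∧
      s.reg 8 = ((Finset.range n).filter fun y => s₀.mem (n * n + 2 * n + y) = 0).card) s₀ := by
  simp only [countIsolated, Halts.seq_iff (p := .const _ _), Halts.seq_iff (p := .move _ _),
    Halts.const_iff, Halts.move_iff]
  refine ⟨by omega, by omega, Halts.while_of_invariant (m := n)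
    (fun j t s => t ≤ 7 * j ∧ s.reg 13 = j ∧ s.reg 15 = n - j ∧
      (∀ r < 13, r ≠ 8 → s.reg r = s₀.reg r) ∧ s.mem = s₀.mem ∧
      s.reg 8 = ((Finset.range j).filter fun y => s₀.mem (n * n + 2 * n + y) = 0).card)
    ?_ ?_ ?_ ?_⟩
  · simp [he.size]
    intro r hr hr8
    simp [hr8, show r ≠ 13 by omega, show r ≠ 15 by omega]
  · rintro j t s ⟨-, -, h, -⟩
    exact h
  · rintro j t s hj ⟨ht, r13, r15, hr, hm, r8⟩
    have hne : ∀ r < 13, r ≠ 13 ∧ r ≠ 15 ∧ r ≠ 16 := by omega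
    have hcard : ((Finset.range j).filter fun y => s₀.mem (n * n + 2 * n + y) = 0).card ≤ n :=
      (Finset.card_le_card (Finset.filter_subset _ _)).trans (by simpa using hj.le)
    have r2 : s.reg 2 = 1 := by rw [hr 2 (by omega) (by omega), he.one]
    have r5 : s.reg 5 = n * n + 2 * n := by rw [hr 5 (by omega) (by omega), he.first]
    rw [Finset.range_add_one, Finset.filter_insert]
    simp [r13, r15, r8, r2, r5, hm]
    refine ⟨by omega, fun hv => ⟨by omega, by omega, by omega, ?_, ?_⟩,
      fun hv => ⟨by omega, by omega, by omega, by omega, ?_, ?_⟩⟩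
    · intro r h h8; simp [hne r h, hr r h h8]
    · simp [hv]
    · intro r h h8; simp [hne r h, h8, hr r h h8]
    · rw [if_pos hv, Finset.card_insert_of_notMem (by simp)]
  · rintro t s ⟨ht, -, -, hr, hm, r8⟩
    exact ⟨by omega, hr, hm, r8⟩

/-- Set register `11` to `1` if some vertex is labelled with the number in register `9`, and to `0`
otherwise. -/
def findLabel : Program :=
  .seq (.const 11 0) <| .seq (.const 13 0) <| .seq (.move 15 0) <| .while 15 <|
  .seq (.add 16 5 13) <| .seq (.load 16 16) <| .seq (.sub 17 16 9) <| .seq (.sub 18 9 16) <|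
  .seq (.add 17 17 18) <| .seq (.ite 17 .skip (.const 11 1)) <|
  .seq (.add 13 13 2) (.sub 15 15 2)

theorem halts_findLabel {H : SimpleGraph ℕ} {n W m : ℕ} {s₀ : State}
    (hW : n * n + 4 * n + 2 ≤ W) (he : Env H n s₀) (h9 : s₀.reg 9 = m) (hm : m ≤ n)
    (hF : ∀ y < n, s₀.mem (n * n + 2 * n + y) ≤ n) :
    Halts W findLabel (fun t s => t ≤ 10 * n + 4 ∧
      (∀ r < 13, r ≠ 11 → s.reg r = s₀.reg r) ∧ s.mem = s₀.mem ∧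
      (s.reg 11 ≠ 0 ↔ ∃ y < n, s₀.mem (n * n + 2 * n + y) = m)) s₀ := by
  simp only [findLabel, Halts.seq_iff (p := .const _ _), Halts.seq_iff (p := .move _ _),
    Halts.const_iff, Halts.move_iff]
  refine ⟨by omega, by omega, Halts.while_of_invariant (m := n)
    (fun j t s => t ≤ 10 * j ∧ s.reg 13 = j ∧ s.reg 15 = n - j ∧
      (∀ r < 13, r ≠ 11 → s.reg r = s₀.reg r) ∧ s.mem = s₀.mem ∧
      (s.reg 11 ≠ 0 ↔ ∃ y < j, s₀.mem (n * n + 2 * n + y) = m))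
    ?_ ?_ ?_ ?_⟩
  · simp [he.size]
    intro r hr hr11
    simp [hr11, show r ≠ 13 by omega, show r ≠ 15 by omega]
  · rintro j t s ⟨-, -, h, -⟩
    exact h
  · rintro j t s hj ⟨ht, r13, r15, hr, hmem, r11⟩
    have hne : ∀ r < 13, r ≠ 13 ∧ r ≠ 15 ∧ r ≠ 16 ∧ r ≠ 17 ∧ r ≠ 18 := by omega
    have r2 : s.reg 2 = 1 := by rw [hr 2 (by omega) (by omega), he.one]
    have r5 : s.reg 5 = n * n + 2 * n := by rw [hr 5 (by omega) (by omega), he.first]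
    have r9 : s.reg 9 = m := by rw [hr 9 (by omega) (by omega), h9]
    have hFj := hF j hj
    rw [Nat.exists_lt_succ_right, ← r11]
    simp only [Halts.seq_iff, Halts.add_iff, Halts.load_iff, Halts.ite_iff, Halts.skip_iff,
      Halts.sub_iff, Halts.const_iff]
    simp only [State.setReg_reg, State.setReg_mem, r13, r15, r2, r5, r9, hmem, Nat.reduceEqDiff,
      if_true, if_false]
    -- The tested value is the sum of both truncated differences, which vanishes exactly if the
    -- label equals `m`.
    refine ⟨by omega, by omega, fun hv => ?_, fun hv => ?_⟩
    · refine ⟨by omega, by omega, trivial, by omega, ?_, trivial, ?_⟩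
      · intro r h h11; simp [hne r h, hr r h h11]
      · have : s₀.mem (n * n + 2 * n + j) ≠ m := by omega
        simp [this]
    · refine ⟨by omega, by omega, by omega, trivial, by omega, ?_, trivial, ?_⟩
      · intro r h h11; simp [hne r h, h11, hr r h h11]
      · have : s₀.mem (n * n + 2 * n + j) = m := by omega
        simp [this]
  · rintro t s ⟨ht, -, -, hr, hmem, r11⟩
    exact ⟨by omega, hr, hmem, r11⟩

/-- Remove the labels of all neighbors of the vertex whose row starts at the address in
register `12`. -/
def eraseLabels : Program :=
  .seq (.const 13 0) <| .seq (.const 14 0) <| .seq (.move 15 0) <| .while 15 <|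
  .seq (.add 16 12 13) <| .seq (.load 16 16) <|
  .seq (.ite 16 (.seq (.add 17 5 13) (.store 17 14)) .skip) <|
  .seq (.add 13 13 2) (.sub 15 15 2)

open Classical in
theorem halts_eraseLabels {H : SimpleGraph ℕ} {n W v : ℕ} {s₀ : State}
    (hW : n * n + 4 * n + 2 ≤ W) (he : Env H n s₀) (hv : v < n) (h12 : s₀.reg 12 = v * n) :
    Halts W eraseLabels (fun t s => t ≤ 8 * n + 4 ∧ (∀ r < 13, s.reg r = s₀.reg r) ∧
      (∀ a, (a < n * n + 2 * n ∨ n * n + 3 * n ≤ a) → s.mem a = s₀.mem a) ∧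
      ∀ y < n, s.mem (n * n + 2 * n + y) =
        if H.Adj v y then 0 else s₀.mem (n * n + 2 * n + y)) s₀ := by
  simp only [eraseLabels, Halts.seq_iff (p := .const _ _), Halts.seq_iff (p := .move _ _),
    Halts.const_iff, Halts.move_iff]
  refine ⟨by omega, by omega, Halts.while_of_invariant (m := n)
    (fun j t s => t ≤ 8 * j ∧ s.reg 13 = j ∧ s.reg 14 = 0 ∧ s.reg 15 = n - j ∧
      (∀ r < 13, s.reg r = s₀.reg r) ∧
      (∀ a, (a < n * n + 2 * n ∨ n * n + 3 * n ≤ a) → s.mem a = s₀.mem a) ∧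
      ∀ y < n, s.mem (n * n + 2 * n + y) =
        if y < j ∧ H.Adj v y then 0 else s₀.mem (n * n + 2 * n + y)) ?_ ?_ ?_ ?_⟩
  · simp [he.size]
    intro r hr
    simp [show r ≠ 13 by omega, show r ≠ 14 by omega, show r ≠ 15 by omega]
  · rintro j t s ⟨-, -, -, h, -⟩
    exact h
  · rintro j t s hj ⟨ht, r13, r14, r15, hr, hm, hF⟩
    have hne : ∀ r < 13, r ≠ 13 ∧ r ≠ 15 ∧ r ≠ 16 ∧ r ≠ 17 := by omega
    have he' : Env H n s := he.congr (fun r h => hr r (by omega)) fun a ha => hm a (by omega)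
    have hlt := mul_add_lt_mul_self hv hj
    have hadj := he'.adj v hv j hj
    have hlt' : ∀ y, y ≠ j → (y < j + 1 ↔ y < j) := by omega
    simp only [Halts.seq_iff, Halts.add_iff, Halts.load_iff, Halts.ite_iff, Halts.skip_iff,
      Halts.sub_iff, Halts.store_iff]
    simp only [State.setReg_reg, State.setReg_mem, State.setMem_reg, State.setMem_mem, r13, r14,
      r15, hr 12, h12, he'.one, he'.first, hadj, Nat.reduceEqDiff, Nat.reduceLT,
      if_true, if_false]
    refine ⟨by omega, fun hv => ?_, fun hv => ?_⟩
    · have hvj : H.Adj v j := by by_contra h; simp [h] at hv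
      refine ⟨by omega, by omega, by omega, trivial, trivial, by omega, ?_, ?_, ?_⟩
      · intro r h; simp [hne r h, hr r h]
      · intro a ha
        rw [if_neg (by omega), hm a ha]
      · intro y hy
        by_cases hyj : y = j
        · subst hyj; simp [hvj]
        · simp [hyj, hF y hy, ← hlt' y hyj]
    · have hvj : ¬ H.Adj v j := by intro h; simp [h] at hv
      refine ⟨by omega, by omega, trivial, trivial, by omega, ?_, hm, ?_⟩
      · intro r h; simp [hne r h, hr r h]
      · intro y hy
        by_cases hyj : y = j
        · subst hyj; simp [hvj, hF y hy]
        · simp [hF y hy, ← hlt' y hyj]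
  · rintro t s ⟨ht, -, -, -, hr, hm, hF⟩
    refine ⟨by omega, hr, hm, fun y hy => ?_⟩
    rw [hF y hy]
    simp [hy]

/-- One round of the greedy algorithm, which treats the vertices whose label is the number in
register `9`. -/
def greedyRound : Program :=
  .seq (.sub 10 9 2) <| .seq (.add 10 6 10) <| .seq (.load 12 10) <| .seq findLabel <|
  .seq (.ite 11 (.seq (.add 7 7 2) eraseLabels) .skip) (.sub 9 9 2)

/-- Compute the size of a greedy cover in register `7`. -/
def greedy : Program := .seq (.const 7 0) (.while 9 greedyRound)

open Classical in
/-- The state of the greedy algorithm before the round with number `i`, where `f` is the labelling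
at the beginning. -/
structure GreedyState (H : SimpleGraph ℕ) (n : ℕ) (ord : ℕ → ℕ) (f : ℕ → ℕ) (i : ℕ)
    (D P : Finset ℕ) (s : State) : Prop where
  env : Env H n s
  index : s.reg 9 = i
  isGreedy : H.IsGreedy n f i (s.reg 7) D P
  order : ∀ l < n, s.mem (n * n + 3 * n + l) = ord l * n
  label : ∀ y < n, s.mem (n * n + 2 * n + y) = if ∃ d ∈ D, H.Adj d y then 0 else f y

/-- Labels of covered vertices have been erased, so `i + 1` still occurs as a label exactly if some
vertex with first neighbor `ord i` is uncovered. The two branches are `IsGreedy.pick` and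
`IsGreedy.skip`. Since one search for a label and one erasure suffice per round, a round is linear.
-/
theorem halts_greedyRound {H : SimpleGraph ℕ} {n W i : ℕ} {ord f : ℕ → ℕ} {D P : Finset ℕ}
    {s₀ : State} (hW : n * n + 4 * n + 2 ≤ W) (hH : H.IsChordalBipartite)
    (hlt : ∀ x y, H.Adj x y → y < n) (hord : H.IsMaxSearchOrder ord n)
    (hord_lt : ∀ l < n, ord l < n) (hsurj : ∀ x < n, ∃ l < n, ord l = x)
    (hf : H.IsFirstIndex n ord n f) (hi : i < n)
    (h : GreedyState H n ord f (i + 1) D P s₀) :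
    Halts W greedyRound (fun t s => t ≤ 18 * n + 15 ∧ s.reg 1 = s₀.reg 1 ∧ s.reg 8 = s₀.reg 8 ∧
      ∃ D P, GreedyState H n ord f i D P s) s₀ := by
  classical
  have he := h.env
  have hle : ∀ y < n, s₀.mem (n * n + 2 * n + y) ≤ n := by
    intro y hy
    rw [h.label y hy]
    split_ifs
    · simp
    · exact hf.le hy
  have hc := h.isGreedy.count_le hlt
  simp only [greedyRound, Halts.seq_iff, Halts.sub_iff, Halts.add_iff, Halts.load_iff]
  simp only [State.setReg_reg, State.setReg_mem, h.index, he.one, he.order, Nat.reduceEqDiff,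
    if_true, if_false, Nat.add_sub_cancel, h.order i hi]
  refine ⟨by omega, ?_⟩
  refine (halts_findLabel (H := H) (n := n) (m := i + 1) hW
    (he.congr ?_ ?_) ?_ hi ?_).mono ?_
  · intro r h
    simp [show r ≠ 10 by omega, show r ≠ 12 by omega]
  · exact fun a ha => rfl
  · simp [h.index]
  · exact hle
  rintro t s ⟨ht, hr, hm, h11⟩
  simp at hr hm h11
  have hne : ∀ r < 10, r < 13 ∧ r ≠ 9 + 1 ∧ r ≠ 10 ∧ r ≠ 11 ∧ r ≠ 12 := by omega
  have hr' : ∀ r < 10, s.reg r = s₀.reg r := fun r h => by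
    rw [hr r (hne r h).1 (by omega)]
    simp [hne r h]
  have h12 : s.reg 12 = ord i * n := by rw [hr 12 (by omega) (by omega)]; simp
  have hmem : ∀ a, s.mem a = s₀.mem a := fun a => by rw [hm]
  have he' : Env H n s := he.congr (fun r h => hr' r (by omega)) fun a ha => hmem a
  rw [Halts.ite_iff]
  refine ⟨fun hpos => ?_, fun hzero => ?_⟩
  · obtain ⟨p, hp, hfp⟩ := h11.1 hpos
    rw [h.label p hp] at hfp
    have hpD : ¬ ∃ d ∈ D, H.Adj d p := by
      intro hex
      simp [hex] at hfp
    rw [if_neg hpD] at hfp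
    have hpick := h.isGreedy.pick hH hlt hord hsurj hf hp hfp (by simpa using hpD)
    rw [Halts.seq_iff, Halts.add_iff]
    refine ⟨by rw [hr' 7 (by omega), hr' 2 (by omega), he.one]; omega, ?_⟩
    refine (halts_eraseLabels (H := H) (n := n) (v := ord i) hW
      (he'.congr ?_ ?_) (hord_lt i hi) ?_).mono ?_
    · intro r h
      simp [show r ≠ 7 by omega]
    · exact fun a ha => rfl
    · simp [h12]
    rintro t' s' ⟨ht', hr'', hm', hF'⟩
    simp at hr'' hm' hF'
    have hr3 : ∀ r < 10, r ≠ 7 → s'.reg r = s₀.reg r := fun r h h7 => by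
      rw [hr'' r (by omega), if_neg h7, hr' r h]
    have h7 : s'.reg 7 = s₀.reg 7 + 1 := by
      rw [hr'' 7 (by omega), if_pos rfl, hr' 7 (by omega), hr' 2 (by omega), he.one]
    simp [hr3, h.index, he.one]
    refine ⟨by omega, _, _, ⟨?_, by simp, by simpa [h7] using hpick, ?_, ?_⟩⟩
    · refine he.congr (fun r h => ?_) fun a ha => ?_
      · simp [show r ≠ 9 by omega, hr3 r (by omega) (by omega)]
      · simp [hm' a (.inl (by omega)), hmem]
    · intro l hl
      simp [hm' (n * n + 3 * n + l) (.inr (by omega)), hmem, h.order l hl]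
    · intro y hy
      simp only [State.setReg_mem, hF' y hy, hmem, h.label y hy, Finset.exists_mem_insert]
      by_cases hyi : H.Adj (ord i) y <;> simp [hyi]
  · have hno : ∀ y < n, f y = i + 1 → ∃ d ∈ D, H.Adj d y := by
      intro y hy hfy
      by_contra hcon
      refine h11.2 ⟨y, hy, ?_⟩ hzero
      rw [h.label y hy, if_neg hcon, hfy]
    simp [hr', h.index, he.one]
    refine ⟨by omega, D, P, ⟨?_, by simp, ?_, ?_, ?_⟩⟩
    · refine he'.congr (fun r h => ?_) fun a ha => rfl
      simp [show r ≠ 9 by omega]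
    · simpa [hr'] using h.isGreedy.skip hno
    · intro l hl
      simp [hmem, h.order l hl]
    · intro y hy
      simp [hmem, h.label y hy]

theorem halts_greedy {H : SimpleGraph ℕ} {n W : ℕ} {ord : ℕ → ℕ} {s₀ : State}
    (hW : n * n + 4 * n + 2 ≤ W) (hH : H.IsChordalBipartite)
    (hlt : ∀ x y, H.Adj x y → y < n) (h : SearchState H n ord n s₀) :
    Halts W greedy (fun t s => t ≤ (18 * n + 16) * n + 2 ∧ s.reg 1 = s₀.reg 1 ∧
      s.reg 8 = s₀.reg 8 ∧ Env H n s ∧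
      ∃ D P, H.IsGreedy n (fun y => s₀.mem (n * n + 2 * n + y)) 0 (s.reg 7) D P) s₀ := by
  rw [greedy, Halts.seq_iff, Halts.const_iff]
  refine ⟨by omega, Halts.while_of_invariant (m := n)
    (fun j t s => t ≤ (18 * n + 16) * j ∧ s.reg 1 = s₀.reg 1 ∧ s.reg 8 = s₀.reg 8 ∧
      ∃ D P, GreedyState H n ord (fun y => s₀.mem (n * n + 2 * n + y)) (n - j) D P s)
    ?_ ?_ ?_ ?_⟩
  -- The search has left `n` in register `9`. No label exceeds `n`, so nothing has to be covered
  -- yet.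
  · refine ⟨by simp, by simp, by simp, ∅, ∅, ⟨?_, ?_, ⟨?_, ?_, ?_, ?_, ?_, ?_⟩, ?_, ?_⟩⟩
    · exact h.env.congr (fun r h => by simp [show r ≠ 7 by omega]) fun a ha => rfl
    · simp [h.index]
    · simp
    · simp
    · intro y hy hfy
      exact absurd (h.first.le hy) (by simpa using hfy)
    · simp
    · simp
    · simp
    · exact h.order
    · simp
  · rintro j t s ⟨-, -, -, D, P, hs⟩
    exact hs.index
  · rintro j t s hj ⟨ht, r1, r8, D, P, hs⟩
    rw [show n - j = n - (j + 1) + 1 by omega] at hs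
    refine (halts_greedyRound hW hH hlt h.isMaxSearchOrder h.ord_lt h.surjective h.first
      (by omega) hs).mono ?_
    rintro t' s' ⟨ht', r1', r8', hs'⟩
    refine ⟨?_, r1'.trans r1, r8'.trans r8, hs'⟩
    rw [Nat.mul_succ]
    omega
  · rintro t s ⟨ht, r1, r8, D, P, hs⟩
    rw [Nat.sub_self] at hs
    exact ⟨by omega, r1, r8, hs.env, D, P, hs.isGreedy⟩

/-- Compute the size of a minimum cover by open neighborhoods in register `7`, and the number of
isolated vertices in register `8`. -/
def coverAndIsolated : Program :=
  .seq setup <| .seq search <| .seq countIsolated greedy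

open Classical in
theorem halts_coverAndIsolated {H : SimpleGraph ℕ} {n W : ℕ} {s₀ : State}
    (hW : n * n + 4 * n + 2 ≤ W) (hH : H.IsChordalBipartite)
    (hlt : ∀ x y, H.Adj x y → y < n) (h0 : s₀.reg 0 = n)
    (hadj : ∀ i < n, ∀ j < n, s₀.mem (i * n + j) = if H.Adj i j then 1 else 0)
    (hzero : ∀ a, n * n ≤ a → s₀.mem a = 0) :
    Halts W coverAndIsolated (fun t s => t ≤ 53 * (n * n) + 52 * n + 19 ∧
      s.reg 1 = s₀.reg 1 ∧ s.reg 2 = 1 ∧ s.reg 7 ≤ n ∧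
      s.reg 8 = ((Finset.range n).filter fun y => ∀ x, ¬ H.Adj x y).card ∧
      ∃ D P : Finset ℕ, D.card ≤ s.reg 7 ∧ s.reg 7 ≤ P.card ∧
        (∀ x y, H.Adj x y → ∃ d ∈ D, H.Adj d y) ∧ (∀ p ∈ P, ∃ x, H.Adj x p) ∧
        ∀ p ∈ P, ∀ q ∈ P, ∀ x, H.Adj x p → H.Adj x q → p = q) s₀ := by
  simp only [coverAndIsolated, Halts.seq_iff]
  refine (halts_setup hW h0).mono ?_
  rintro t₁ s₁ ⟨ht₁, r0, r1, r2, r3, r4, r5, r6, hm₁⟩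
  refine (halts_search (H := H) hW hlt ⟨r0, r2, r3, r4, r5, r6, ?_⟩ ?_).mono ?_
  · rwa [hm₁]
  · rwa [hm₁]
  rintro t₂ s₂ ⟨ht₂, r1', ord, hs⟩
  -- The count precedes the greedy phase, which erases labels: here a label `0` still means that
  -- there is no neighbor at all, because the order lists every vertex.
  refine (halts_countIsolated hW hs.env).mono ?_
  rintro t₃ s₃ ⟨ht₃, hr₃, hm₃, r8⟩
  have hs₃ : SearchState H n ord n s₃ := by
    refine ⟨hs.env.congr (fun r h => hr₃ r (by omega) (by omega)) fun a _ => by rw [hm₃],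
      by rw [hr₃ 9 (by omega) (by omega), hs.index],
      by rw [hr₃ 10 (by omega) (by omega), hs.counter], hs.ord_lt, hs.ord_inj,
      hs.isMaxSearchOrder, ?_, ?_, ?_, ?_⟩ <;> rw [hm₃]
    exacts [hs.order, hs.visited, hs.first, hs.count]
  refine (halts_greedy hW hH hlt hs₃).mono ?_
  rintro t₄ s₄ ⟨ht₄, r1'', r8', he, D, P, hg⟩
  have hfirst_pos : ∀ x y, H.Adj x y → s₃.mem (n * n + 2 * n + y) ≠ 0 := by
    intro x y hxy h
    obtain ⟨l, hl, rfl⟩ := hs₃.surjective x (hlt y x hxy.symm)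
    exact (hs₃.first.eq_zero_iff (hlt _ y hxy)).1 h l hl hxy
  refine ⟨by nlinarith, ?_, he.one, hg.count_le hlt, ?_, D, P, hg.card_le, hg.le_card, ?_,
    hg.nonisolated, hg.packing⟩
  · rw [r1'', hr₃ 1 (by omega) (by omega), r1', r1]
  · rw [r8', r8]
    congr 1
    refine Finset.filter_congr fun y hy => ?_
    rw [← hm₃]
    refine ⟨fun h x hxy => hfirst_pos x y hxy h, fun h => ?_⟩
    exact (hs₃.first.eq_zero_iff (Finset.mem_range.1 hy)).2 fun l _ => h _
  · intro x y hxy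
    exact hg.cover y (hlt x y hxy) (Nat.pos_of_ne_zero (hfirst_pos x y hxy))

end WordRAM

/-! ### From cover-packing duality to the three graph parameters. -/

namespace SimpleGraph

variable {V U : Type*} {G : SimpleGraph V}

theorem IsChordalBipartite.of_embedding {G' : SimpleGraph U} (hG : G.IsChordalBipartite)
    (e : G' ↪g G) : G'.IsChordalBipartite :=
  ⟨hG.1.of_hom e.toHom, fun k hk ⟨e'⟩ => hG.2 k hk ⟨e.comp e'⟩⟩

/-- The image only gains isolated vertices, and a cycle contains none. This transfers graphs to `ℕ`,
where the programs are analyzed. -/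
theorem IsChordalBipartite.map (hG : G.IsChordalBipartite) (f : V ↪ U) :
    (G.map f).IsChordalBipartite := by
  constructor
  · obtain ⟨col⟩ : G.Colorable 2 := hG.1
    refine ⟨Coloring.mk (Function.extend f col fun _ => 0) ?_⟩
    rintro _ _ ⟨-, u, v, huv, rfl, rfl⟩
    rw [f.injective.extend_apply, f.injective.extend_apply]
    exact col.valid huv
  · rintro k hk ⟨e⟩
    obtain ⟨m, rfl⟩ : ∃ m, k = m + 2 := ⟨k - 2, by omega⟩
    have hrange : ∀ i, ∃ v, f v = e i := by
      intro i
      have hadj : (G.map f).Adj (e i) (e (i + 1)) := by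
        rw [e.map_adj_iff, cycleGraph_adj]
        right
        simp
      obtain ⟨-, u, -, -, hu, -⟩ := hadj
      exact ⟨u, hu⟩
    choose g hg using hrange
    refine hG.2 _ hk ⟨⟨⟨g, fun i j hij => e.injective ?_⟩, fun {i j} => ?_⟩⟩
    · rw [← hg, ← hg, hij]
    · rw [← e.map_adj_iff, ← hg, ← hg]
      exact (map_adj_apply (f := f)).symm

/-- There are a family of at most `c` open neighborhoods that covers the non-isolated vertices, and
a set of at least `c` non-isolated vertices of which no two have a common neighbor. -/
def HasCoverPacking (G : SimpleGraph V) (c : ℕ) : Prop :=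
  ∃ D P : Finset V, D.card ≤ c ∧ c ≤ P.card ∧ (∀ x y, G.Adj x y → ∃ d ∈ D, G.Adj d y) ∧
    (∀ p ∈ P, ∃ x, G.Adj x p) ∧ ∀ p ∈ P, ∀ q ∈ P, ∀ x, G.Adj x p → G.Adj x q → p = q

/-- Cover elements outside the range of `f` are isolated and can be dropped; packing elements are
non-isolated, so none of them is lost. -/
theorem HasCoverPacking.of_map {f : V ↪ U} {c : ℕ} (h : (G.map f).HasCoverPacking c) :
    G.HasCoverPacking c := by
  classical
  obtain ⟨D, P, hD, hP, hcover, hnon, hpack⟩ := h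
  have hadj : ∀ {u v}, (G.map f).Adj (f u) (f v) ↔ G.Adj u v := map_adj_apply
  refine ⟨D.preimage f f.injective.injOn, P.preimage f f.injective.injOn, ?_, ?_, ?_, ?_, ?_⟩
  · rw [Finset.card_preimage]
    exact (Finset.card_filter_le _ _).trans hD
  · rw [Finset.card_preimage, Finset.filter_true_of_mem]
    · exact hP
    · intro p hp
      obtain ⟨x, -, u, v, -, -, rfl⟩ := hnon p hp
      exact ⟨v, rfl⟩
  · intro x y hxy
    obtain ⟨d, hd, hdy⟩ := hcover (f x) (f y) (hadj.2 hxy)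
    have hdy' := hdy
    obtain ⟨-, u, v, -, rfl, -⟩ := hdy'
    exact ⟨u, Finset.mem_preimage.2 hd, hadj.1 hdy⟩
  · intro p hp
    obtain ⟨x, hx⟩ := hnon _ (Finset.mem_preimage.1 hp)
    have hx' := hx
    obtain ⟨-, u, v, -, rfl, -⟩ := hx'
    exact ⟨u, hadj.1 hx⟩
  · intro p hp q hq x hxp hxq
    exact f.injective (hpack _ (Finset.mem_preimage.1 hp) _ (Finset.mem_preimage.1 hq) (f x)
      (hadj.2 hxp) (hadj.2 hxq))

/-- The number of isolated vertices. -/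
noncomputable def isolatedCount (G : SimpleGraph V) : ℕ :=
  Nat.card {v // ∀ w, ¬ G.Adj v w}

theorem isolatedCount_eq_zero_iff [Finite V] : G.isolatedCount = 0 ↔ G.NoIsolatedVertex := by
  rw [isolatedCount, Finite.card_eq_zero_iff, isEmpty_subtype]
  simp [NoIsolatedVertex]

theorem IsBipartite.not_adj_of_common_neighbor (hG : G.IsBipartite) {u v w : V}
    (hu : G.Adj w u) (hv : G.Adj w v) : ¬ G.Adj u v := by
  obtain ⟨col⟩ : G.Colorable 2 := hG
  intro huv
  have h1 := col.valid hu
  have h2 := col.valid hv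
  have h3 := col.valid huv
  omega

theorem IsBipartite.dist_eq_two (hG : G.IsBipartite) {u v w : V} (huv : u ≠ v)
    (hu : G.Adj w u) (hv : G.Adj w v) : G.dist u v = 2 := by
  have hle : G.dist u v ≤ 2 := dist_le (Walk.cons hu.symm (Walk.cons hv Walk.nil))
  have hreach : G.Reachable u v := ⟨Walk.cons hu.symm (Walk.cons hv Walk.nil)⟩
  have h0 : G.dist u v ≠ 0 := fun h => huv (hreach.dist_eq_zero_iff.1 h)
  have h1 : G.dist u v ≠ 1 := fun h =>
    hG.not_adj_of_common_neighbor hu hv (dist_eq_one_iff_adj.1 h)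
  omega

theorem exists_common_neighbor_of_dist_eq_two {u v : V} (h : G.dist u v = 2) :
    u ≠ v ∧ ∃ w, G.Adj w u ∧ G.Adj w v := by
  have hreach : G.Reachable u v := Reachable.of_dist_ne_zero (by omega)
  obtain ⟨p, hp⟩ := hreach.exists_walk_length_eq_dist
  refine ⟨?_, ?_⟩
  · rintro rfl
    simp at h
  · rw [h] at hp
    match p, hp with
    | .cons h1 (.cons h2 .nil), _ => exact ⟨_, h1.symm, h2⟩

/-- Weak duality: two vertices of one color class have a common neighbor, hence distance 2, so each
class meets `S` at most once. -/
theorem IsSeparatedCluster.card_le (hG : G.IsBipartite) {S : Finset V}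
    (hS : G.IsSeparatedCluster S) {k : ℕ} (hk : G.CDColorable k) : S.card ≤ k := by
  obtain ⟨c, hc⟩ := hk
  rw [← Fintype.card_fin k, ← Finset.card_univ]
  refine Finset.card_le_card_of_injOn c (fun _ _ => Finset.mem_coe.2 (Finset.mem_univ _)) ?_
  intro u hu v hv huv
  by_contra hne
  rcases hc u with ⟨w, hw⟩ | ⟨-, h⟩
  · exact hS u hu v hv (hG.dist_eq_two hne (hw u rfl) (hw v huv.symm))
  · exact hne (h v huv.symm).symm

/-- Distinct packing vertices need distinct dominators, and without isolated vertices the cover is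
itself a total dominating set. -/
theorem HasCoverPacking.totalDomination_iff {c : ℕ} (h : G.HasCoverPacking c)
    (hno : G.NoIsolatedVertex) {k : ℕ} : G.TotalDomination k ↔ c ≤ k := by
  obtain ⟨D, P, hD, hP, hcover, -, hpack⟩ := h
  constructor
  · rintro ⟨S, hS, hk⟩
    choose g hg hadj using hS
    refine hP.trans (le_trans ?_ hk)
    refine Finset.card_le_card_of_injOn g (fun p _ => hg p) ?_
    intro p hp q hq hpq
    exact hpack p hp q hq (g p) (hadj p).symm (hpq ▸ (hadj q).symm)
  · intro hk
    refine ⟨D, fun v => ?_, hD.trans hk⟩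
    obtain ⟨w, hw⟩ := hno v
    obtain ⟨d, hd, hdv⟩ := hcover w v hw.symm
    exact ⟨d, hd, hdv.symm⟩

theorem HasCoverPacking.totalDominationNumber_eq {c : ℕ} (h : G.HasCoverPacking c)
    (hno : G.NoIsolatedVertex) : G.totalDominationNumber = c := by
  refine le_antisymm ?_ (le_iInf₂ fun S hS => Nat.cast_le.2 ?_)
  · obtain ⟨S, hS, hcard⟩ := (h.totalDomination_iff hno).2 le_rfl
    exact (iInf₂_le S hS).trans (Nat.cast_le.2 hcard)
  · exact (h.totalDomination_iff hno).1 ⟨S, hS, le_rfl⟩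

variable [Finite V]

/-- Each non-isolated vertex is colored by an adjacent member of the cover, each isolated vertex by
itself. The coloring is proper because open neighborhoods in a bipartite graph are independent. -/
theorem HasCoverPacking.cdColorable {c : ℕ} (h : G.HasCoverPacking c) (hG : G.IsBipartite) {k : ℕ}
    (hk : c + G.isolatedCount ≤ k) : G.CDColorable k := by
  classical
  have := Fintype.ofFinite V
  obtain ⟨D, -, hD, -, hcover, -⟩ := h
  have hex : ∀ u, ∃ x : D ⊕ {v // ∀ w, ¬ G.Adj v w}, (∀ d, x = .inl d → G.Adj d u) ∧
      ∀ i, x = .inr i → i = u := by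
    intro u
    by_cases hu : ∀ w, ¬ G.Adj u w
    · exact ⟨.inr ⟨u, hu⟩, by simp, by simp⟩
    · push Not at hu
      obtain ⟨w, hw⟩ := hu
      obtain ⟨d, hd, hdu⟩ := hcover w u hw.symm
      exact ⟨.inl ⟨d, hd⟩, by simpa using hdu, by simp⟩
  choose col hcol hcol' using hex
  obtain ⟨e⟩ : Nonempty (D ⊕ {v // ∀ w, ¬ G.Adj v w} ↪ Fin k) := by
    refine Function.Embedding.nonempty_of_card_le ?_
    rw [Fintype.card_sum, Fintype.card_coe, Fintype.card_fin, ← Nat.card_eq_fintype_card]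
    exact (Nat.add_le_add_right hD _).trans hk
  refine ⟨Coloring.mk (fun u => e (col u)) fun {u v} huv heq => ?_, fun u => ?_⟩
  · have heq := e.injective heq
    rcases hu : col u with d | i
    · exact hG.not_adj_of_common_neighbor (hcol u d hu) (hcol v d (heq ▸ hu)) huv
    · exact i.2 v (by rwa [hcol' u i hu])
  · rcases hu : col u with d | i
    · exact .inl ⟨d, fun w hw => hcol w d ((e.injective hw).trans hu)⟩
    · refine .inr ⟨by rw [← hcol' u i hu]; exact i.2, fun w hw => ?_⟩
      rw [← hcol' u i hu, ← hcol' w i ((e.injective hw).trans hu)]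

/-- The cluster is the packing together with all isolated vertices; these two sets are disjoint. -/
theorem HasCoverPacking.exists_isSeparatedCluster {c : ℕ} (h : G.HasCoverPacking c) :
    ∃ S : Finset V, G.IsSeparatedCluster S ∧ c + G.isolatedCount ≤ S.card := by
  classical
  have := Fintype.ofFinite V
  obtain ⟨-, P, -, hP, -, hnon, hpack⟩ := h
  refine ⟨P ∪ Finset.univ.filter fun v => ∀ w, ¬ G.Adj v w, fun u hu v hv huv => ?_, ?_⟩
  · obtain ⟨hne, w, hwu, hwv⟩ := exists_common_neighbor_of_dist_eq_two huv
    simp only [Finset.mem_union, Finset.mem_filter, Finset.mem_univ, true_and] at hu hv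
    rcases hu with hu | hu
    · rcases hv with hv | hv
      · exact hne (hpack u hu v hv w hwu hwv)
      · exact hv w hwv.symm
    · exact hu w hwu.symm
  · rw [Finset.card_union_of_disjoint, isolatedCount, Nat.card_eq_fintype_card,
      Fintype.card_subtype]
    · exact Nat.add_le_add_right hP _
    · refine Finset.disjoint_left.2 fun p hp hp' => ?_
      obtain ⟨x, hx⟩ := hnon p hp
      exact (Finset.mem_filter.1 hp').2 x hx.symm

theorem HasCoverPacking.cdColorable_iff {c : ℕ} (h : G.HasCoverPacking c) (hG : G.IsBipartite)
    {k : ℕ} : G.CDColorable k ↔ c + G.isolatedCount ≤ k := by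
  refine ⟨fun hk => ?_, h.cdColorable hG⟩
  obtain ⟨S, hS, hcard⟩ := h.exists_isSeparatedCluster
  exact hcard.trans (hS.card_le hG hk)

theorem HasCoverPacking.separatedCluster_iff {c : ℕ} (h : G.HasCoverPacking c)
    (hG : G.IsBipartite) {k : ℕ} : G.SeparatedCluster k ↔ k ≤ c + G.isolatedCount := by
  constructor
  · rintro ⟨S, hS, hk⟩
    exact hk.trans (hS.card_le hG (h.cdColorable hG le_rfl))
  · intro hk
    obtain ⟨S, hS, hcard⟩ := h.exists_isSeparatedCluster
    exact ⟨S, hS, hk.trans hcard⟩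

theorem HasCoverPacking.cdChromaticNumber_eq {c : ℕ} (h : G.HasCoverPacking c)
    (hG : G.IsBipartite) : G.cdChromaticNumber = (c + G.isolatedCount : ℕ) :=
  le_antisymm (iInf₂_le _ ((h.cdColorable_iff hG).2 le_rfl))
    (le_iInf₂ fun _ hk => Nat.cast_le.2 ((h.cdColorable_iff hG).1 hk))

theorem HasCoverPacking.separatedClusterNumber_eq {c : ℕ} (h : G.HasCoverPacking c)
    (hG : G.IsBipartite) : G.separatedClusterNumber = (c + G.isolatedCount : ℕ) := by
  refine le_antisymm (iSup₂_le fun S hS => Nat.cast_le.2 ?_) ?_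
  · exact (h.separatedCluster_iff hG).1 ⟨S, hS, le_rfl⟩
  · obtain ⟨S, hS, hcard⟩ := h.exists_isSeparatedCluster
    exact (Nat.cast_le.2 hcard).trans (le_iSup₂_of_le S hS le_rfl)

end SimpleGraph

/-! ### The input encoding, and the min-max statement from the program. -/

namespace WordRAM

open SimpleGraph

open Classical in
theorem inputState_mem_mul_add {n : ℕ} (G : SimpleGraph (Fin n)) (k : ℕ) {i j : ℕ} (hi : i < n)
    (hj : j < n) : (inputState G k).mem (i * n + j) =
      if (G.map Fin.valEmbedding).Adj i j then 1 else 0 := by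
  simp only [inputState]
  congr 1
  apply propext
  constructor
  · rintro ⟨i', j', h, hadj⟩
    have hn : 0 < n := by omega
    have h1 : i = i' := by
      have := congrArg (· / n) h
      simpa [Nat.add_div_of_dvd_right, Nat.mul_div_cancel _ hn, Nat.div_eq_of_lt hj,
        Nat.div_eq_of_lt j'.2] using this
    have h2 : j = j' := by
      rw [h1] at h
      exact Nat.add_left_cancel h
    subst h1 h2
    exact (map_adj_apply (f := Fin.valEmbedding)).2 hadj
  · rintro ⟨-, u, v, huv, rfl, rfl⟩
    exact ⟨u, v, rfl, huv⟩

theorem inputState_mem_eq_zero {n : ℕ} (G : SimpleGraph (Fin n)) (k : ℕ) {a : ℕ}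
    (ha : n * n ≤ a) : (inputState G k).mem a = 0 := by
  simp only [inputState]
  rw [if_neg]
  rintro ⟨i, j, h, -⟩
  have := mul_add_lt_mul_self i.2 j.2
  omega

theorem halts_coverAndIsolated_inputState {n W : ℕ} (G : SimpleGraph (Fin n)) (k : ℕ)
    (hG : G.IsChordalBipartite) (hW : n * n + 4 * n + 2 ≤ W) :
    Halts W coverAndIsolated (fun t s => t ≤ 53 * (n * n) + 52 * n + 19 ∧ s.reg 1 = k ∧
      s.reg 7 ≤ n ∧ s.reg 8 ≤ n ∧ s.reg 8 = G.isolatedCount ∧ G.HasCoverPacking (s.reg 7))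
      (inputState G k) := by
  classical
  refine (halts_coverAndIsolated (H := G.map Fin.valEmbedding) hW (hG.map _) ?_ ?_ ?_ ?_).mono ?_
  · rintro _ _ ⟨-, u, v, -, rfl, rfl⟩
    exact v.2
  · simp [inputState]
  · intro i hi j hj
    convert inputState_mem_mul_add G k hi hj
  · exact fun a ha => inputState_mem_eq_zero G k ha
  · rintro t s ⟨ht, h1, -, h7, h8, hdual⟩
    refine ⟨ht, by simpa [inputState] using h1, h7, ?_, ?_, HasCoverPacking.of_map hdual⟩
    · rw [h8]
      exact (Finset.card_filter_le _ _).trans (Finset.card_range n).le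
    · rw [h8, isolatedCount, Nat.card_eq_fintype_card, Fintype.card_subtype,
        ← Finset.card_map Fin.valEmbedding]
      congr 1
      ext y
      simp only [Finset.mem_filter, Finset.mem_range, Finset.mem_map, Finset.mem_univ, true_and]
      constructor
      · rintro ⟨hy, h⟩
        exact ⟨⟨y, hy⟩, fun w hw => h w ((map_adj_apply (f := Fin.valEmbedding)).2 hw.symm), rfl⟩
      · rintro ⟨v, hv, rfl⟩
        refine ⟨v.2, ?_⟩
        rintro _ ⟨-, u, w, huw, rfl, hw⟩
        rw [Fin.valEmbedding.injective hw] at huw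
        exact hv u huw.symm

end WordRAM

namespace SimpleGraph

/-- The cover and the packing are taken from a run of the program on a copy of `G` with vertices in
`Fin n`; only existence matters here, so the word bound is simply chosen large enough. -/
theorem IsChordalBipartite.exists_hasCoverPacking {V : Type*} [Finite V] {G : SimpleGraph V}
    (hG : G.IsChordalBipartite) : ∃ c, G.HasCoverPacking c := by
  obtain ⟨n, ⟨e⟩⟩ := Finite.exists_equiv_fin V
  obtain ⟨t, s, -, -, -, -, -, -, h⟩ :=
    WordRAM.halts_coverAndIsolated_inputState (G.map e.toEmbedding) 0 (hG.map _) le_rfl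
  exact ⟨_, h.of_map⟩

end SimpleGraph

/-! ### Quadratic time bounds and the main theorem. -/

namespace WordRAM

open SimpleGraph

theorem mul_self_add_le_pow {n m C : ℕ} (hC : 2 ≤ C) (hm : n + 2 ≤ m) :
    n * n + 4 * n + 2 ≤ m ^ C :=
  calc n * n + 4 * n + 2 ≤ m ^ 2 := by nlinarith
    _ ≤ m ^ C := Nat.pow_le_pow_right (by omega) hC

theorem computableInTime_of_coverAndIsolated {𝒞 : ∀ ⦃n : ℕ⦄, SimpleGraph (Fin n) → Prop}
    {f : ∀ ⦃n : ℕ⦄, SimpleGraph (Fin n) → ℕ∞} (p : Program)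
    (h𝒞 : ∀ ⦃n⦄ (G : SimpleGraph (Fin n)), 𝒞 G → G.IsChordalBipartite)
    (hp : ∀ ⦃n⦄ (G : SimpleGraph (Fin n)) (W : ℕ) (s : State), 𝒞 G → 2 * n + 1 < W →
      s.reg 7 ≤ n → s.reg 8 ≤ n → s.reg 8 = G.isolatedCount → G.HasCoverPacking (s.reg 7) →
      Halts W p (fun t s' => t ≤ 10 ∧ (s'.reg 0 : ℕ∞) = f G) s) :
    ComputableInTime 𝒞 f (fun n => n ^ 2) := by
  -- `53 * (n * n) + 52 * n` is at most `105 * (n * n)`. The same constant is the exponent of the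
  -- word bound, for which `2` would already do for the common part.
  refine ⟨.seq coverAndIsolated p, 105, fun n G hG => ?_⟩
  have hW := mul_self_add_le_pow (C := 105) (by norm_num) (le_refl (n + 2))
  generalize (n + 2) ^ 105 = W at hW ⊢
  obtain ⟨t₁, s₁, he₁, ht₁, -, h7, h8, h8', hc⟩ :=
    halts_coverAndIsolated_inputState G 0 (h𝒞 G hG) hW
  obtain ⟨t₂, s₂, he₂, ht₂, hs₂⟩ := hp G W s₁ hG (by omega) h7 h8 h8' hc
  refine ⟨_, s₂, .seq he₁ he₂, ?_, hs₂⟩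
  have : n ≤ n * n := Nat.le_mul_self n
  simp only [sq]
  omega

theorem decidableInTime_of_coverAndIsolated {Q : ∀ ⦃n : ℕ⦄, SimpleGraph (Fin n) → ℕ → Prop}
    (p : Program)
    (hp : ∀ ⦃n⦄ (G : SimpleGraph (Fin n)) (k W : ℕ) (s : State), G.IsChordalBipartite →
      2 * n + 1 < W → s.reg 1 = k → s.reg 7 ≤ n → s.reg 8 ≤ n → s.reg 8 = G.isolatedCount →
      G.HasCoverPacking (s.reg 7) →
      Halts W p (fun t s' => t ≤ 10 ∧ (Q G k → s'.reg 0 = 1) ∧ (¬ Q G k → s'.reg 0 = 0)) s) :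
    DecidableInTime (fun _ G => G.IsChordalBipartite) Q (fun n => n ^ 2) := by
  refine ⟨.seq coverAndIsolated p, 105, fun n G k hG => ?_⟩
  have hW := mul_self_add_le_pow (C := 105) (by norm_num) (show n + 2 ≤ n + k + 2 by omega)
  generalize (n + k + 2) ^ 105 = W at hW ⊢
  obtain ⟨t₁, s₁, he₁, ht₁, h1, h7, h8, h8', hc⟩ := halts_coverAndIsolated_inputState G k hG hW
  obtain ⟨t₂, s₂, he₂, ht₂, hs₂⟩ := hp G k W s₁ hG (by omega) h1 h7 h8 h8' hc
  refine ⟨_, s₂, .seq he₁ he₂, ?_, hs₂⟩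
  have : n ≤ n * n := Nat.le_mul_self n
  simp only [sq]
  omega

end WordRAM

theorem theorem4 :
    (∀ (V : Type*) [Finite V] (G : SimpleGraph V), G.IsChordalBipartite →
      G.IsCDPerfect ∧
      G.cdChromaticNumber = G.separatedClusterNumber ∧
      (∀ k : ℕ, G.CDColorable k ↔ ¬ G.SeparatedCluster (k + 1)) ∧
      (G.NoIsolatedVertex →
        G.totalDominationNumber = G.cdChromaticNumber ∧
        ∀ k : ℕ, G.TotalDomination k ↔ G.CDColorable k)) ∧
    WordRAM.ComputableInTime (fun _ G => G.IsChordalBipartite ∧ G.NoIsolatedVertex)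
      (fun _ G => G.totalDominationNumber) (fun n => n ^ 2) ∧
    WordRAM.ComputableInTime (fun _ G => G.IsChordalBipartite)
      (fun _ G => G.cdChromaticNumber) (fun n => n ^ 2) ∧
    WordRAM.ComputableInTime (fun _ G => G.IsChordalBipartite)
      (fun _ G => G.separatedClusterNumber) (fun n => n ^ 2) ∧
    WordRAM.DecidableInTime (fun _ G => G.IsChordalBipartite)
      (fun _ G k => G.TotalDomination k) (fun n => n ^ 2) ∧
    WordRAM.DecidableInTime (fun _ G => G.IsChordalBipartite)
      (fun _ G k => G.CDColorable k) (fun n => n ^ 2) ∧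
    WordRAM.DecidableInTime (fun _ G => G.IsChordalBipartite)
      (fun _ G k => G.SeparatedCluster k) (fun n => n ^ 2) := by
  refine ⟨fun V _ G hG => ?_, ?_, ?_, ?_, ?_, ?_, ?_⟩
  · obtain ⟨c, hc⟩ := hG.exists_hasCoverPacking
    refine ⟨fun s => ?_, ?_, fun k => ?_, fun hno => ⟨?_, fun k => ?_⟩⟩
    · have hs := hG.of_embedding (SimpleGraph.Embedding.induce s)
      obtain ⟨c', hc'⟩ := hs.exists_hasCoverPacking
      rw [hc'.cdChromaticNumber_eq hs.1, hc'.separatedClusterNumber_eq hs.1]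
    · rw [hc.cdChromaticNumber_eq hG.1, hc.separatedClusterNumber_eq hG.1]
    · rw [hc.cdColorable_iff hG.1, hc.separatedCluster_iff hG.1]
      omega
    · rw [hc.totalDominationNumber_eq hno, hc.cdChromaticNumber_eq hG.1,
        SimpleGraph.isolatedCount_eq_zero_iff.2 hno, add_zero]
    · rw [hc.totalDomination_iff hno, hc.cdColorable_iff hG.1,
        SimpleGraph.isolatedCount_eq_zero_iff.2 hno, add_zero]
  · refine WordRAM.computableInTime_of_coverAndIsolated (.move 0 7) (fun _ _ h => h.1) ?_
    intro n G W s hG hW h7 h8 h8' hc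
    simp [hc.totalDominationNumber_eq hG.2]
  · refine WordRAM.computableInTime_of_coverAndIsolated (.add 0 7 8) (fun _ _ h => h) ?_
    intro n G W s hG hW h7 h8 h8' hc
    rw [hc.cdChromaticNumber_eq hG.1, ← h8']
    simp
    omega
  · refine WordRAM.computableInTime_of_coverAndIsolated (.add 0 7 8) (fun _ _ h => h) ?_
    intro n G W s hG hW h7 h8 h8' hc
    rw [hc.separatedClusterNumber_eq hG.1, ← h8']
    simp
    omega
  -- Isolated vertices are allowed in this decision problem; if there is one, no total dominating
  -- set exists and the answer is no. Otherwise the truncated difference `c - k` is tested.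
  · refine WordRAM.decidableInTime_of_coverAndIsolated (.ite 8 (.const 0 0)
      (.seq (.sub 9 7 1) (.ite 9 (.const 0 0) (.const 0 1)))) ?_
    intro n G k W s hG hW h1 h7 h8 h8' hc
    simp only [WordRAM.Halts.ite_iff, WordRAM.Halts.seq_iff, WordRAM.Halts.sub_iff,
      WordRAM.Halts.const_iff]
    simp [h1]
    refine ⟨fun hpos => ⟨by omega, fun ⟨S, hS, _⟩ => hpos ?_⟩, fun hzero => ?_⟩
    · rw [h8', SimpleGraph.isolatedCount_eq_zero_iff]
      exact fun v => let ⟨w, _, hw⟩ := hS v; ⟨w, hw⟩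
    · rw [hc.totalDomination_iff (SimpleGraph.isolatedCount_eq_zero_iff.1 (h8' ▸ hzero))]
      omega
  · refine WordRAM.decidableInTime_of_coverAndIsolated (.seq (.add 7 7 8)
      (.seq (.sub 9 7 1) (.ite 9 (.const 0 0) (.const 0 1)))) ?_
    intro n G k W s hG hW h1 h7 h8 h8' hc
    rw [hc.cdColorable_iff hG.1, ← h8']
    simp [h1]
    omega
  · refine WordRAM.decidableInTime_of_coverAndIsolated (.seq (.add 7 7 8)
      (.seq (.sub 9 1 7) (.ite 9 (.const 0 0) (.const 0 1)))) ?_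
    intro n G k W s hG hW h1 h7 h8 h8' hc
    rw [hc.separatedCluster_iff hG.1, ← h8']
    simp [h1]
    omega
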